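/- Let $K$ be a finite connected CW complex of dimension at most two, with fundamental group $\Pi=\pi_1(K,x_0)$ for a base point $x_0\in K$. Identify $\mathrm{Aut}(\mathbb{Z})$ with $\mathbb{Z}_2=\{1,-1\}$, so that each homomorphism $\alpha\in\hom(\Pi,\mathbb{Z}_2)$ is a local integer coefficient system over $K$, and let $H^2(K;{}_{\alpha}\mathbb{Z})$ denote the second (singular) cohomology group of $K$ with coefficients in this local system. If $H^2(K;{}_{\beta}\mathbb{Z})$ is finite of odd order for some $\beta\in\hom(\Pi,\mathbb{Z}_2)$, then $H^2(K;{}_{\alpha}\mathbb{Z})$ is finite of odd order for every $\alpha\in\hom(\Pi,\mathbb{Z}_2)$. -/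

import Mathlib

open Topology

noncomputable section

namespace LocalCoeff

/-- The standard topological `n`-simplex. -/
abbrev Simplex (n : ℕ) : Type := stdSimplex ℝ (Fin (n + 1))

/-- The leading vertex `e₀` of the standard `n`-simplex. -/
abbrev e₀ (n : ℕ) : Simplex n := stdSimplex.vertex 0

/-- The affine map of standard simplices given by a map of their vertices. -/
def simplexMap {m n : ℕ} (f : Fin (m + 1) → Fin (n + 1)) : C(Simplex m, Simplex n) :=
  ⟨stdSimplex.map f, stdSimplex.continuous_map f⟩

/-- The straight path between two points of a standard simplex. -/
def segmentPath {n : ℕ} (v w : Simplex n) : Path v w where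
  toFun t := ⟨AffineMap.lineMap (v : Fin (n + 1) → ℝ) w (t : ℝ),
    (convex_stdSimplex ℝ (Fin (n + 1))).lineMap_mem v.2 w.2 t.2⟩
  continuous_toFun := by
    refine Continuous.subtype_mk ?_ _
    simp only [AffineMap.lineMap_apply]
    fun_prop
  source' := Subtype.ext (AffineMap.lineMap_apply_zero _ _)
  target' := Subtype.ext (AffineMap.lineMap_apply_one _ _)

variable {X : Type*} [TopologicalSpace X] {x₀ : X}

/-- The fibre over `x` of the local system of infinite cyclic groups on `X` associated with
`α : π₁(X, x₀) → {1, -1} = Aut ℤ`: the functions `f` on the homotopy classes of paths from `x₀`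
to `x` (that is, on the fibre over `x` of the universal covering) with values in `ℤ` that are
equivariant, `f (g · γ) = α g * f γ`. If `x` can be joined to `x₀`, evaluation at any `γ`
identifies the fibre with `ℤ`. -/
def fibre (α : FundamentalGroup X x₀ →* ℤˣ) (x : X) :
    Submodule ℤ (Path.Homotopic.Quotient x₀ x → ℤ) where
  carrier := {f | ∀ (g : FundamentalGroup X x₀) (γ : Path.Homotopic.Quotient x₀ x),
    f (g.toPath.trans γ) = (α g : ℤ) * f γ}
  add_mem' hf hg a γ := by simp [hf a γ, hg a γ, mul_add]
  zero_mem' _ _ := by simp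
  smul_mem' c f hf a γ := by simp [hf a γ, mul_left_comm]

/-- The parallel transport of the local system along (the inverse of) a path class
`δ` from `x` to `y`, as a map from the fibre over `y` to the fibre over `x`. -/
def transport (α : FundamentalGroup X x₀ →* ℤˣ) {x y : X} (δ : Path.Homotopic.Quotient x y) :
    fibre α y →ₗ[ℤ] fibre α x where
  toFun f := ⟨fun γ => f.1 (γ.trans δ), fun g γ =>
    (congrArg f.1 (Path.Homotopic.Quotient.trans_assoc g.toPath γ δ)).trans (f.2 g _)⟩
  map_add' _ _ := rfl
  map_smul' _ _ := rfl

/-- Singular `n`-cochains of `X` with coefficients in the local system of `α`: a cochain assigns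
to a singular simplex `σ` an element of the fibre over its leading vertex `σ e₀`. -/
abbrev Cochain (α : FundamentalGroup X x₀ →* ℤˣ) (n : ℕ) : Type _ :=
  (σ : C(Simplex n, X)) → fibre α (σ (e₀ n))

/-- The map of cochains induced by a map of vertices: `φ` is evaluated on `σ ∘ f`, and the value,
which lies in the fibre over `σ (f e₀)`, is transported to the fibre over `σ e₀` along the image
under `σ` of the straight path from `e₀` to `f e₀`. -/
def pull (α : FundamentalGroup X x₀ →* ℤˣ) {m n : ℕ} (f : Fin (m + 1) → Fin (n + 1)) :
    Cochain α m →ₗ[ℤ] Cochain α n :=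
  LinearMap.pi fun σ =>
    (transport α (x := σ (e₀ n)) (y := (σ.comp (simplexMap f)) (e₀ m))
        ((Path.Homotopic.Quotient.mk (segmentPath (e₀ n) (simplexMap f (e₀ m)))).map σ)).comp
      (LinearMap.proj (σ.comp (simplexMap f)))

/-- The coboundary `δ = ∑ᵢ (-1)ⁱ dᵢ` of the singular cochain complex with local coefficients. -/
def coboundary (α : FundamentalGroup X x₀ →* ℤˣ) (n : ℕ) :
    Cochain α n →ₗ[ℤ] Cochain α (n + 1) :=
  ∑ i : Fin (n + 2), (-1 : ℤ) ^ (i : ℕ) • pull α i.succAbove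

theorem apply_eq_of_heq {α : FundamentalGroup X x₀ →* ℤˣ} {n : ℕ} (φ : Cochain α n)
    {σ τ : C(Simplex n, X)} (h : σ = τ) {γ : Path.Homotopic.Quotient x₀ (σ (e₀ n))}
    {γ' : Path.Homotopic.Quotient x₀ (τ (e₀ n))} (hγ : HEq γ γ') :
    (φ σ).1 γ = (φ τ).1 γ' := by
  subst h; rw [eq_of_heq hγ]

instance (n : ℕ) : ContractibleSpace (Simplex n) :=
  (convex_stdSimplex ℝ (Fin (n + 1))).contractibleSpace ⟨_, (e₀ n).2⟩

theorem pull_comp (α : FundamentalGroup X x₀ →* ℤˣ) {l m n : ℕ}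
    (f : Fin (m + 1) → Fin (n + 1)) (g : Fin (l + 1) → Fin (m + 1)) :
    (pull α f).comp (pull α g) = pull α (f ∘ g) := by
  ext φ σ γ
  have hfg (v : Simplex l) : simplexMap (f ∘ g) v = simplexMap f (simplexMap g v) :=
    (stdSimplex.map_comp_apply g f v).symm
  have key {w w' : Simplex n} (hw : w = w') (P : Path.Homotopic.Quotient (e₀ n) w)
      (Q : Path.Homotopic.Quotient (e₀ n) w') : HEq (γ.trans (P.map σ)) (γ.trans (Q.map σ)) := by
    subst hw; rw [Subsingleton.elim P Q]
  refine apply_eq_of_heq φ (ContinuousMap.ext fun v => congrArg σ (hfg v).symm) ?_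
  refine HEq.trans (heq_of_eq ?_) (key (hfg (e₀ l)).symm
    ((Path.Homotopic.Quotient.mk (segmentPath (e₀ n) (simplexMap f (e₀ m)))).trans
      ((Path.Homotopic.Quotient.mk (segmentPath (e₀ m) (simplexMap g (e₀ l)))).map
        (simplexMap f))) _)
  rw [Path.Homotopic.Quotient.trans_assoc]
  congr 1
  simp only [← Path.Homotopic.Quotient.mk_map, ← Path.Homotopic.Quotient.mk_trans]
  rw [Path.map_trans]
  rfl

/-- The square of the coboundary is zero. -/
theorem coboundary_comp_coboundary (α : FundamentalGroup X x₀ →* ℤˣ) (n : ℕ) :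
    (coboundary α (n + 1)).comp (coboundary α n) = 0 := by
  ext1 φ
  have pull_pull (i : Fin (n + 3)) (j : Fin (n + 2)) :
      pull α i.succAbove (pull α j.succAbove φ) = pull α (i.succAbove ∘ j.succAbove) φ :=
    LinearMap.congr_fun (pull_comp α _ _) φ
  simp only [coboundary, LinearMap.comp_apply, LinearMap.sum_apply, LinearMap.smul_apply, map_sum,
    map_smul, Finset.smul_sum, smul_smul, ← pow_add, pull_pull, LinearMap.zero_apply]
  rw [Finset.sum_comm, ← Finset.sum_product', Finset.univ_product_univ]
  have face_face (i : Fin (n + 3)) (j : Fin (n + 2)) (h : (j : ℕ) < i) :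
      i.succAbove ∘ j.succAbove =
        j.castSucc.succAbove ∘ (i.pred (by rintro rfl; simp at h)).succAbove := by
    ext k
    simp only [Function.comp, Fin.succAbove, Fin.lt_def]
    grind
  refine Finset.sum_involution (fun (p : Fin (n + 3) × Fin (n + 2)) _ =>
    if h : (p.2 : ℕ) < p.1 then
      (p.2.castSucc, p.1.pred (by intro h0; simp [h0] at h))
    else (p.2.succ, p.1.castLT (by omega))) ?_ ?_ ?_ ?_
  · rintro ⟨i, j⟩ -
    by_cases h : (j : ℕ) < i
    · simp only [h, dite_true, face_face i j h]
      rw [← add_smul]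
      convert zero_smul ℤ _
      obtain ⟨k, rfl⟩ := Fin.eq_succ_of_ne_zero (show i ≠ 0 by rintro rfl; simp at h)
      simp; ring
    · have h' : ((i.castLT (by omega) : Fin (n + 2)) : ℕ) < j.succ := by simp; omega
      simp only [h, dite_false, face_face _ _ h']
      simp only [Fin.castSucc_castLT, Fin.pred_succ]
      rw [← add_smul]
      convert zero_smul ℤ _
      simp; ring
  · rintro ⟨i, j⟩ - - he
    split_ifs at he with h
    · have := congrArg (fun p => (p.1 : ℕ)) he
      simp at this h; omega
    · have := congrArg (fun p => (p.1 : ℕ)) he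
      simp at this h; omega
  · simp
  · rintro ⟨i, j⟩ -
    by_cases h : (j : ℕ) < i
    · have : ¬ ((i : ℕ) - 1 < j) := by omega
      simp [h, this]
    · have : (i : ℕ) < j + 1 := by omega
      simp [h, this]

/-- The group of `n`-coboundaries. -/
def boundaries (α : FundamentalGroup X x₀ →* ℤˣ) : (n : ℕ) → Submodule ℤ (Cochain α n)
  | 0 => ⊥
  | n + 1 => LinearMap.range (coboundary α n)

/-- The `n`-th (singular) cohomology group `Hⁿ(X; _αℤ)` of `X` with coefficients in the local
system of `α : π₁(X, x₀) → {1, -1} = Aut ℤ`: cocycles modulo coboundaries. -/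
abbrev Cohomology (α : FundamentalGroup X x₀ →* ℤˣ) (n : ℕ) : Type _ :=
  LinearMap.ker (coboundary α n) ⧸ (boundaries α n).submoduleOf (LinearMap.ker (coboundary α n))

end LocalCoeff

end

/-! Reduction modulo two forgets the twist. The coefficient systems `α` and `β` differ only by
signs, so their coboundaries agree modulo 2. The quotient H²(K; _αℤ)/2 always embeds in H²(K; ℤ/2),
and it is all of it when H³(K; _αℤ) = 0. In dimension at most two, whether H² is divisible by 2 is
therefore independent of the local system. A finite abelian group of odd order is 2-divisible;
conversely a finitely generated 2-divisible abelian group is finite of odd order (Nakayama and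
Cauchy). `TwoDivisible.transfer` carries the first point, `finite_odd_card_of_two_divisible` the
second.

What remains is topological: for a finite complex of dimension at most two, twisted singular
cohomology is finitely generated and vanishes from degree 3 on
(`CohomologyBound.of_finite_complex`). Open cells are added one at a time. The new space is covered
by the complement of the centre of the cell, which deforms into the old space, and by the open cell,
which is contractible; they meet in a punctured ball. Only half of Mayer-Vietoris is needed: control
of the kernel of restriction to the two pieces. Since ℤ is noetherian, the image of restriction is
automatically finitely generated.

Mayer-Vietoris and homotopy invariance are proved for singular chains with a sign cocycle (`Twist`)
in place of a local system. Cochains are always functionals on all chains of `X`; the cohomology of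
a subset is obtained by imposing the cocycle and coboundary conditions only on simplices inside it,
so restriction is an inclusion of submodules. Subdivision and prism operators are constructed on
formal tuples of points of a simplex or prism, where the twist is trivialised, and then pushed into
`X`. -/

noncomputable section

/-! ### Formal operators on tuples: cones, subdivision, prisms. -/

namespace TwistedSingular

/-! ### Chains of ordered tuples

The augmented complex of ordered tuples of points of a type: a tuple of length `k` has
dimension `k - 1`. -/

/-- Integral chains of ordered `k`-tuples of points of `Y`. -/
abbrev TupleChain (Y : Type*) (k : ℕ) : Type _ := (Fin k → Y) →₀ ℤ

namespace TupleChain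

variable {Y Y' : Type*} {k : ℕ}

/-- The generator given by a tuple. -/
abbrev of (v : Fin k → Y) : TupleChain Y k := Finsupp.single v 1

/-- The boundary, omitting the entries of a tuple one at a time. -/
def bd (k : ℕ) : TupleChain Y (k + 1) →ₗ[ℤ] TupleChain Y k :=
  Finsupp.linearCombination ℤ fun v => ∑ i : Fin (k + 1), (-1 : ℤ) ^ (i : ℕ) • of (v ∘ i.succAbove)

/-- The cone with apex `b`. -/
def cone (b : Y) (k : ℕ) : TupleChain Y k →ₗ[ℤ] TupleChain Y (k + 1) :=
  Finsupp.lmapDomain ℤ ℤ fun v => (Fin.cons b v : Fin (k + 1) → Y)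

/-- The chain map induced by a map of points. -/
def map (f : Y → Y') (k : ℕ) : TupleChain Y k →ₗ[ℤ] TupleChain Y' k :=
  Finsupp.lmapDomain ℤ ℤ fun v => f ∘ v

theorem bd_of (v : Fin (k + 1) → Y) :
    bd k (of v) = ∑ i : Fin (k + 1), (-1 : ℤ) ^ (i : ℕ) • of (v ∘ i.succAbove) := by
  simp [bd]

@[simp] theorem cone_of (b : Y) (v : Fin k → Y) : cone b k (of v) = of (Fin.cons b v) := by
  simp [cone]

@[simp] theorem map_of (f : Y → Y') (v : Fin k → Y) : map f k (of v) = of (f ∘ v) := by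
  simp [map]

theorem hom_ext {M : Type*} [AddCommGroup M] {f g : TupleChain Y k →ₗ[ℤ] M}
    (h : ∀ v, f (of v) = g (of v)) : f = g :=
  Finsupp.lhom_ext' fun v => LinearMap.ext_ring (h v)

theorem bd_map (f : Y → Y') (c : TupleChain Y (k + 1)) :
    bd k (map f (k + 1) c) = map f k (bd k c) := by
  suffices h : (bd k).comp (map f (k + 1)) = (map f k).comp (bd k) from LinearMap.congr_fun h c
  refine hom_ext fun v => ?_
  simp only [LinearMap.comp_apply, map_of, bd_of, map_sum, map_smul]
  rfl

theorem map_cone (f : Y → Y') (b : Y) (c : TupleChain Y k) :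
    map f (k + 1) (cone b k c) = cone (f b) k (map f k c) := by
  suffices h : (map f (k + 1)).comp (cone b k) = (cone (f b) k).comp (map f k) from
    LinearMap.congr_fun h c
  refine hom_ext fun v => ?_
  simp only [LinearMap.comp_apply, map_of, cone_of]
  congr 1
  ext i
  refine Fin.cases ?_ (fun j => ?_) i <;> simp

/-- Omitting the apex returns the tuple; every other face is the cone on a face, with its sign
shifted by one. This contracting homotopy is behind all the later identities. -/
theorem bd_cone (b : Y) (c : TupleChain Y (k + 1)) :
    bd (k + 1) (cone b (k + 1) c) = c - cone b k (bd k c) := by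
  suffices h : (bd (k + 1)).comp (cone b (k + 1)) = LinearMap.id - (cone b k).comp (bd k) from
    LinearMap.congr_fun h c
  refine hom_ext fun v => ?_
  simp only [LinearMap.comp_apply, LinearMap.sub_apply, LinearMap.id_apply, cone_of, bd_of,
    map_sum, map_smul]
  rw [Fin.sum_univ_succ, sub_eq_add_neg, ← Finset.sum_neg_distrib]
  have h0 : (Fin.cons b v : Fin (k + 2) → Y) ∘ Fin.succAbove 0 = v := by ext i; simp
  have hs (i : Fin (k + 1)) : (Fin.cons b v : Fin (k + 2) → Y) ∘ i.succ.succAbove =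
      Fin.cons b (v ∘ i.succAbove) := by
    ext j
    refine Fin.cases ?_ (fun j => ?_) j <;> simp
  simp only [h0, hs]
  simp [pow_succ]

theorem bd_cone_zero (b : Y) (c : TupleChain Y 0) : bd 0 (cone b 0 c) = c := by
  suffices h : (bd 0).comp (cone b 0) = LinearMap.id from LinearMap.congr_fun h c
  refine hom_ext fun v => ?_
  simp only [LinearMap.comp_apply, cone_of, bd_of, LinearMap.id_apply]
  simp [Subsingleton.elim _ v]

/-- A tuple is the cone from its first entry on its tail, so the cone formula lowers the degree and
no double sum over faces is needed. -/
theorem bd_bd : ∀ {k : ℕ} (c : TupleChain Y (k + 2)), bd k (bd (k + 1) c) = 0 := by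
  intro k c
  suffices h : (bd k).comp (bd (k + 1)) = (0 : TupleChain Y (k + 2) →ₗ[ℤ] TupleChain Y k) from
    LinearMap.congr_fun h c
  clear c
  refine hom_ext fun v => ?_
  rw [← Fin.cons_self_tail v, ← cone_of]
  generalize of (Fin.tail v) = c
  simp only [LinearMap.comp_apply, bd_cone, map_sub, LinearMap.zero_apply]
  induction k with
  | zero => simp [bd_cone_zero]
  | succ k ih =>
    have : bd k (bd (k + 1) c) = 0 := by
      suffices h : (bd k).comp (bd (k + 1)) = (0 : TupleChain Y (k + 2) →ₗ[ℤ] TupleChain Y k) from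
        LinearMap.congr_fun h c
      refine hom_ext fun v => ?_
      rw [← Fin.cons_self_tail v, ← cone_of]
      simpa only [LinearMap.comp_apply, bd_cone, map_sub, LinearMap.zero_apply] using ih _ _
    simp [bd_cone, this]

/-! ### Subdivision -/

/-- Subdivision of tuples with respect to a choice of centres. -/
def sd (β : ∀ k, (Fin (k + 1) → Y) → Y) : ∀ k, TupleChain Y k →ₗ[ℤ] TupleChain Y k
  | 0 => LinearMap.id
  | k + 1 => Finsupp.linearCombination ℤ fun v => cone (β k v) k (sd β k (bd k (of v)))

/-- The chain homotopy between the identity and the subdivision. -/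
def sdHomotopy (β : ∀ k, (Fin (k + 1) → Y) → Y) : ∀ k, TupleChain Y k →ₗ[ℤ] TupleChain Y (k + 1)
  | 0 => 0
  | k + 1 => Finsupp.linearCombination ℤ fun v =>
      cone (β k v) (k + 1) (of v - sdHomotopy β k (bd k (of v)))

variable {β : ∀ k, (Fin (k + 1) → Y) → Y} {β' : ∀ k, (Fin (k + 1) → Y') → Y'}

theorem sd_succ_of (v : Fin (k + 1) → Y) :
    sd β (k + 1) (of v) = cone (β k v) k (sd β k (bd k (of v))) := by
  simp [sd]

theorem sdHomotopy_succ_of (v : Fin (k + 1) → Y) :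
    sdHomotopy β (k + 1) (of v) =
      cone (β k v) (k + 1) (of v - sdHomotopy β k (bd k (of v))) := by
  simp [sdHomotopy]

theorem bd_sd : ∀ {k : ℕ} (c : TupleChain Y (k + 1)),
    bd k (sd β (k + 1) c) = sd β k (bd k c) := by
  intro k
  suffices h : (bd k).comp (sd β (k + 1)) = (sd β k).comp (bd k) from LinearMap.congr_fun h
  induction k with
  | zero =>
    refine hom_ext fun v => ?_
    simp only [LinearMap.comp_apply, sd_succ_of, bd_cone_zero]
  | succ k ih =>
    refine hom_ext fun v => ?_
    have := LinearMap.congr_fun ih (bd (k + 1) (of v))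
    simp only [LinearMap.comp_apply] at this
    simp only [LinearMap.comp_apply, sd_succ_of, bd_cone, this, bd_bd, map_zero, sub_zero]

/-- Write T for the homotopy. On a tuple v with centre b, T v is the cone b·(v − T∂v); by induction
v − T∂v has boundary sd ∂v, and b·(sd ∂v) is sd v. -/
theorem bd_sdHomotopy (c : TupleChain Y (k + 1)) :
    bd (k + 1) (sdHomotopy β (k + 1) c) = c - sd β (k + 1) c - sdHomotopy β k (bd k c) := by
  revert c
  suffices h : (bd (k + 1)).comp (sdHomotopy β (k + 1)) =
      LinearMap.id - sd β (k + 1) - (sdHomotopy β k).comp (bd k) from LinearMap.congr_fun h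
  induction k with
  | zero =>
    refine hom_ext fun v => ?_
    simp only [LinearMap.comp_apply, LinearMap.sub_apply, LinearMap.id_apply, sd_succ_of,
      sdHomotopy_succ_of, bd_cone]
    simp only [sdHomotopy, sd, LinearMap.zero_apply, LinearMap.id_apply, sub_zero]
  | succ k ih =>
    refine hom_ext fun v => ?_
    have := LinearMap.congr_fun ih (bd (k + 1) (of v))
    simp only [LinearMap.comp_apply, LinearMap.sub_apply, LinearMap.id_apply, bd_bd, map_zero]
      at this
    simp only [LinearMap.comp_apply, LinearMap.sub_apply, LinearMap.id_apply,
      sd_succ_of (k := k + 1), sdHomotopy_succ_of (k := k + 1), bd_cone, map_sub, this]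
    abel

theorem map_sd {f : Y → Y'} (hf : ∀ k v, f (β k v) = β' k (f ∘ v)) (c : TupleChain Y k) :
    map f k (sd β k c) = sd β' k (map f k c) := by
  revert c
  suffices h : (map f k).comp (sd β k) = (sd β' k).comp (map f k) from LinearMap.congr_fun h
  induction k with
  | zero => rfl
  | succ k ih =>
    refine hom_ext fun v => ?_
    have := LinearMap.congr_fun ih (bd k (of v))
    simp only [LinearMap.comp_apply] at this
    simp only [LinearMap.comp_apply, map_of, sd_succ_of, map_cone, this, hf, ← bd_map]

theorem map_sdHomotopy {f : Y → Y'} (hf : ∀ k v, f (β k v) = β' k (f ∘ v)) (c : TupleChain Y k) :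
    map f (k + 1) (sdHomotopy β k c) = sdHomotopy β' k (map f k c) := by
  revert c
  suffices h : (map f (k + 1)).comp (sdHomotopy β k) = (sdHomotopy β' k).comp (map f k) from
    LinearMap.congr_fun h
  induction k with
  | zero => simp [sdHomotopy]
  | succ k ih =>
    refine hom_ext fun v => ?_
    have := LinearMap.congr_fun ih (bd k (of v))
    simp only [LinearMap.comp_apply] at this
    simp only [LinearMap.comp_apply, map_of, sdHomotopy_succ_of, map_cone, map_sub, this, hf,
      ← bd_map]

/-! ### The prism operator -/

/-- The prism operator from tuples in `Y` to tuples in `Y × I` for a type `I` with two chosen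
points. -/
def prism {I : Type*} (a b : I) : ∀ k, TupleChain Y k →ₗ[ℤ] TupleChain (Y × I) (k + 1)
  | 0 => 0
  | k + 1 => Finsupp.linearCombination ℤ fun v => cone (v 0, a) (k + 1)
      (of (fun i => (v i, b)) - of (fun i => (v i, a)) - prism a b k (bd k (of v)))

variable {I : Type*} {a b : I}

theorem prism_succ_of (v : Fin (k + 1) → Y) :
    prism a b (k + 1) (of v) = cone (v 0, a) (k + 1)
      (of (fun i => (v i, b)) - of (fun i => (v i, a)) - prism a b k (bd k (of v))) := by
  simp [prism]

/-- By induction top − bottom − prism(∂v) is a cycle, so it is the boundary of its cone. In degree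
zero this uses the augmentation: the two copies of the empty tuple coincide. -/
theorem bd_prism (c : TupleChain Y (k + 1)) :
    bd (k + 1) (prism a b (k + 1) c) =
      map (·, b) (k + 1) c - map (·, a) (k + 1) c - prism a b k (bd k c) := by
  revert c
  suffices h : (bd (k + 1)).comp (prism (Y := Y) a b (k + 1)) =
      map (·, b) (k + 1) - map (·, a) (k + 1) - (prism a b k).comp (bd k) from
    LinearMap.congr_fun h
  have hm (x : I) {k : ℕ} (v : Fin k → Y) : of (fun i => (v i, x)) = map (·, x) k (of v) := by
    rw [map_of]; rfl
  induction k with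
  | zero =>
    refine hom_ext fun v => ?_
    simp only [LinearMap.comp_apply, LinearMap.sub_apply, prism_succ_of, bd_cone, hm]
    simp only [prism, LinearMap.zero_apply, sub_zero, map_sub, bd_map]
    have (c : TupleChain Y 0) : map (·, b) 0 c = map (·, a) 0 c := by
      simp only [map]; congr 2; exact funext fun v => Subsingleton.elim _ _
    simp [this]
  | succ k ih =>
    refine hom_ext fun v => ?_
    have := LinearMap.congr_fun ih (bd (k + 1) (of v))
    simp only [LinearMap.comp_apply, LinearMap.sub_apply, bd_bd, map_zero, sub_zero] at this
    simp only [LinearMap.comp_apply, LinearMap.sub_apply, prism_succ_of (k := k + 1), bd_cone, hm]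
    simp only [map_sub, bd_map, this, sub_self, map_zero, sub_zero]

theorem map_prism (f : Y → Y') (c : TupleChain Y k) :
    map (Prod.map f id) (k + 1) (prism a b k c) = prism a b k (map f k c) := by
  revert c
  suffices h : (map (Prod.map f id) (k + 1)).comp (prism a b k) = (prism a b k).comp (map f k) from
    LinearMap.congr_fun h
  induction k with
  | zero => simp [prism]
  | succ k ih =>
    refine hom_ext fun v => ?_
    have := LinearMap.congr_fun ih (bd k (of v))
    simp only [LinearMap.comp_apply] at this
    simp only [LinearMap.comp_apply, map_of, prism_succ_of, map_cone, map_sub, this, ← bd_map]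
    rfl

end TupleChain

end TwistedSingular

/-! ### Twisted singular chains and their barycentric subdivision. -/

namespace TwistedSingular

open LocalCoeff (Simplex simplexMap)

/-! ### Affine simplices -/

/-- The vertices of the standard simplex. -/
abbrev vert {n : ℕ} (i : Fin (n + 1)) : Simplex n := stdSimplex.vertex i

/-- The affine simplex in a convex set spanned by a tuple of points. -/
def convexLin {E : Type*} [AddCommGroup E] [Module ℝ E] [TopologicalSpace E]
    [IsTopologicalAddGroup E] [ContinuousSMul ℝ E] {Y : Set E} (hY : Convex ℝ Y) {m : ℕ}
    (v : Fin (m + 1) → Y) : C(Simplex m, Y) where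
  toFun t := ⟨∑ i, t.1 i • (v i : E),
    hY.sum_mem (fun i _ => t.2.1 i) t.2.2 fun i _ => (v i).2⟩
  continuous_toFun := by
    refine Continuous.subtype_mk (continuous_finsetSum _ fun i _ => ?_) _
    exact ((continuous_apply i).comp continuous_subtype_val).smul continuous_const

/-- The affine map of standard simplices with given values at the vertices. -/
def simplexLin {m k : ℕ} (v : Fin (m + 1) → Simplex k) : C(Simplex m, Simplex k) :=
  convexLin (convex_stdSimplex ℝ (Fin (k + 1))) v

/-- A space in which tuples of points span affine simplices. -/
class AffineSimplices (Y : Type*) [TopologicalSpace Y] where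
  /-- The affine simplex spanned by a tuple. -/
  lin {m : ℕ} (v : Fin (m + 1) → Y) : C(Simplex m, Y)
  lin_vert {m : ℕ} (v : Fin (m + 1) → Y) (i : Fin (m + 1)) : lin v (vert i) = v i
  lin_lin {m k : ℕ} (v : Fin (m + 1) → Y) (u : Fin (k + 1) → Simplex m) :
    (lin v).comp (simplexLin u) = lin (lin v ∘ u)

open AffineSimplices (lin lin_vert lin_lin)

section convex

variable {E : Type*} [AddCommGroup E] [Module ℝ E] [TopologicalSpace E]
    [IsTopologicalAddGroup E] [ContinuousSMul ℝ E] {Y : Set E}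

theorem convexLin_coe (hY : Convex ℝ Y) {m : ℕ} (v : Fin (m + 1) → Y) (t : Simplex m) :
    (convexLin hY v t : E) = ∑ i, t.1 i • (v i : E) := rfl

/-- Convex sets contain the affine simplices spanned by their tuples. -/
@[reducible] def AffineSimplices.ofConvex (hY : Convex ℝ Y) : AffineSimplices Y where
  lin := convexLin hY
  lin_vert v i := by
    apply Subtype.ext
    rw [convexLin_coe]
    simp [Pi.single_apply]
  lin_lin v u := by
    refine ContinuousMap.ext fun t => Subtype.ext ?_
    simp only [ContinuousMap.comp_apply, convexLin_coe, simplexLin, Function.comp_apply,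
      Finset.smul_sum, Finset.sum_apply, Finset.sum_smul, Pi.smul_apply, smul_eq_mul, smul_smul]
    rw [Finset.sum_comm]

end convex

instance (n : ℕ) : AffineSimplices (Simplex n) :=
  AffineSimplices.ofConvex (convex_stdSimplex ℝ (Fin (n + 1)))

instance : AffineSimplices unitInterval :=
  AffineSimplices.ofConvex (convex_Icc (0 : ℝ) 1)

instance {Y Z : Type*} [TopologicalSpace Y] [TopologicalSpace Z] [AffineSimplices Y]
    [AffineSimplices Z] : AffineSimplices (Y × Z) where
  lin v := (lin (Prod.fst ∘ v)).prodMk (lin (Prod.snd ∘ v))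
  lin_vert v i := by simp [lin_vert]
  lin_lin v u := by
    ext t
    · exact DFunLike.congr_fun (lin_lin (Prod.fst ∘ v) u) t
    · exact DFunLike.congr_fun (lin_lin (Prod.snd ∘ v) u) t

theorem lin_simplex_coe {m n : ℕ} (v : Fin (m + 1) → Simplex n) (t : Simplex m) :
    (lin v t).1 = ∑ i, t.1 i • (v i).1 := rfl

theorem lin_vert_eq_id (n : ℕ) : lin (fun i : Fin (n + 1) => vert i) = ContinuousMap.id _ := by
  refine ContinuousMap.ext fun t => Subtype.ext ?_
  rw [lin_simplex_coe]
  funext j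
  simp [Pi.single_apply, Finset.sum_apply]

theorem lin_vert_comp {m n : ℕ} (f : Fin (m + 1) → Fin (n + 1)) :
    lin (fun i => vert (f i)) = simplexMap f := by
  refine ContinuousMap.ext fun t => Subtype.ext ?_
  rw [lin_simplex_coe]
  change _ = (stdSimplex.map f t).1
  rw [show (stdSimplex.map f t).1 = _ from stdSimplex.map_coe f t]
  funext j
  simp [Pi.single_apply, Finset.sum_apply, FunOnFinite.linearMap_apply_apply, Finset.sum_ite,
    eq_comm (a := j)]
  rfl

variable {Y : Type*} [TopologicalSpace Y] [AffineSimplices Y]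

theorem lin_comp_simplexMap {m n : ℕ} (v : Fin (n + 1) → Y) (f : Fin (m + 1) → Fin (n + 1)) :
    (lin v).comp (simplexMap f) = lin (v ∘ f) := by
  rw [← lin_vert_comp]
  refine (lin_lin v fun i => vert (f i)).trans ?_
  congr 1
  ext i
  simp [lin_vert]

/-- The barycentre of a tuple of points. -/
def bary (m : ℕ) (v : Fin (m + 1) → Y) : Y := lin v stdSimplex.barycenter

theorem lin_bary {m : ℕ} (v : Fin (m + 1) → Y) (k : ℕ) (u : Fin (k + 1) → Simplex m) :
    lin v (bary k u) = bary k (lin v ∘ u) :=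
  DFunLike.congr_fun (lin_lin v u) stdSimplex.barycenter

/-! ### Twisted singular chains -/

variable {X : Type*} [TopologicalSpace X]

/-- A multiplicative singular `1`-cocycle with values in `{1, -1}`: a local system of infinite
cyclic groups with a generator chosen at each point. -/
structure Twist (X : Type*) [TopologicalSpace X] where
  /-- The sign of the transport along a path. -/
  sign : C(Simplex 1, X) → ℤˣ
  cocycle (σ : C(Simplex 2, X)) :
    sign (σ.comp (simplexMap ![0, 1])) * sign (σ.comp (simplexMap ![1, 2])) =
      sign (σ.comp (simplexMap ![0, 2]))

namespace Twist

variable (w : Twist X)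

/-- The sign of the image under `G` of the segment from `y` to `z`. -/
def seg (G : C(Y, X)) (y z : Y) : ℤˣ := w.sign (G.comp (lin ![y, z]))

theorem seg_mul_seg (G : C(Y, X)) (x y z : Y) : w.seg G x y * w.seg G y z = w.seg G x z := by
  have := w.cocycle (G.comp (lin ![x, y, z]))
  simp only [ContinuousMap.comp_assoc, lin_comp_simplexMap] at this
  convert this using 2 <;> simp only [seg] <;> congr 3 <;> ext i <;> fin_cases i <;> rfl

@[simp] theorem seg_self (G : C(Y, X)) (y : Y) : w.seg G y y = 1 := by
  exact mul_eq_left.1 (w.seg_mul_seg G y y y)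

theorem seg_comp_lin (G : C(Y, X)) {n : ℕ} (v : Fin (n + 1) → Y) (s t : Simplex n) :
    w.seg (G.comp (lin v)) s t = w.seg G (lin v s) (lin v t) := by
  simp only [seg, ContinuousMap.comp_assoc]
  congr 2
  refine (lin_lin v ![s, t]).trans ?_
  congr 1
  ext i; fin_cases i <;> rfl

end Twist

/-- Integral singular chains. -/
abbrev Chain (X : Type*) [TopologicalSpace X] (n : ℕ) : Type _ := C(Simplex n, X) →₀ ℤ

namespace Chain

variable {n : ℕ}

/-- The generator given by a singular simplex. -/
abbrev of (σ : C(Simplex n, X)) : Chain X n := Finsupp.single σ 1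

theorem hom_ext {M : Type*} [AddCommGroup M] {f g : Chain X n →ₗ[ℤ] M}
    (h : ∀ v, f (of v) = g (of v)) : f = g :=
  Finsupp.lhom_ext' fun v => LinearMap.ext_ring (h v)

end Chain

/-- The boundary of singular chains twisted by `w`. -/
def bd (w : Twist X) (n : ℕ) : Chain X (n + 1) →ₗ[ℤ] Chain X n :=
  Finsupp.linearCombination ℤ fun σ => ∑ i : Fin (n + 2),
    ((-1 : ℤ) ^ (i : ℕ) * (w.seg σ (vert 0) (vert (i.succAbove 0)) : ℤˣ)) •
      Chain.of (σ.comp (simplexMap i.succAbove))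

/-- The map from chains of tuples in `Y` to twisted singular chains induced by `G : Y → X` and
the trivialisation of the pulled back local system along segments from `y₀`. -/
def push (w : Twist X) (G : C(Y, X)) (y₀ : Y) (n : ℕ) : TupleChain Y (n + 1) →ₗ[ℤ] Chain X n :=
  Finsupp.linearCombination ℤ fun v => (w.seg G y₀ (v 0) : ℤ) • Chain.of (G.comp (lin v))

variable (w : Twist X) {n : ℕ}

theorem bd_of (σ : C(Simplex (n + 1), X)) : bd w n (Chain.of σ) = ∑ i : Fin (n + 2),
    ((-1 : ℤ) ^ (i : ℕ) * (w.seg σ (vert 0) (vert (i.succAbove 0)) : ℤˣ)) •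
      Chain.of (σ.comp (simplexMap i.succAbove)) := by
  simp [bd]

theorem push_of (G : C(Y, X)) (y₀ : Y) (v : Fin (n + 1) → Y) :
    push w G y₀ n (TupleChain.of v) =
      (w.seg G y₀ (v 0) : ℤ) • Chain.of (G.comp (lin v)) := by
  simp [push]

/-- Signs multiply along segments, so measuring each leading vertex from `y₀` absorbs the twist of
the zeroth face. Twisted identities thus follow from untwisted ones for tuples. -/
theorem bd_push (G : C(Y, X)) (y₀ : Y) (c : TupleChain Y (n + 2)) :
    bd w n (push w G y₀ (n + 1) c) = push w G y₀ n (TupleChain.bd (n + 1) c) := by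
  revert c
  suffices h : (bd w n).comp (push w G y₀ (n + 1)) =
      (push w G y₀ n).comp (TupleChain.bd (n + 1)) from LinearMap.congr_fun h
  refine TupleChain.hom_ext fun v => ?_
  simp only [LinearMap.comp_apply, push_of, map_smul, bd_of, TupleChain.bd_of, map_sum,
    Finset.smul_sum, smul_smul, w.seg_comp_lin, lin_vert, ContinuousMap.comp_assoc,
    lin_comp_simplexMap, Function.comp_apply]
  refine Finset.sum_congr rfl fun i _ => ?_
  rw [← w.seg_mul_seg G y₀ (v 0) (v (i.succAbove 0))]
  push_cast
  congr 1
  ring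

/-- The tautological simplex of a standard simplex. -/
abbrev taut (n : ℕ) : TupleChain (Simplex n) (n + 1) := TupleChain.of fun i => vert i

theorem push_taut (σ : C(Simplex n, X)) : push w σ (vert 0) n (taut n) = Chain.of σ := by
  rw [push_of, w.seg_self, lin_vert_eq_id]
  simp

theorem bd_eq_push (σ : C(Simplex (n + 1), X)) :
    bd w n (Chain.of σ) = push w σ (vert 0) n (TupleChain.bd (n + 1) (taut (n + 1))) := by
  rw [← bd_push, push_taut]

theorem bd_bd (c : Chain X (n + 2)) : bd w n (bd w (n + 1) c) = 0 := by
  revert c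
  suffices h : (bd w n).comp (bd w (n + 1)) = 0 from LinearMap.congr_fun h
  refine Chain.hom_ext fun σ => ?_
  simp [bd_eq_push, bd_push, TupleChain.bd_bd]

/-- Moving the base point of the trivialisation from `y₀` to `H z₀` multiplies it by the sign of the
segment between them. -/
theorem push_comp {Z : Type*} [TopologicalSpace Z] [AffineSimplices Z] (G : C(Y, X)) (y₀ : Y)
    (H : C(Z, Y)) (hH : ∀ {m : ℕ} (u : Fin (m + 1) → Z), H.comp (lin u) = lin (H ∘ u)) (z₀ : Z)
    (c : TupleChain Z (n + 1)) :
    (w.seg G y₀ (H z₀) : ℤ) • push w (G.comp H) z₀ n c =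
      push w G y₀ n (TupleChain.map H (n + 1) c) := by
  suffices h : (w.seg G y₀ (H z₀) : ℤ) • push w (G.comp H) z₀ n =
      (push w G y₀ n).comp (TupleChain.map H (n + 1)) from LinearMap.congr_fun h c
  refine TupleChain.hom_ext fun u => ?_
  have hseg : w.seg (G.comp H) z₀ (u 0) = w.seg G (H z₀) (H (u 0)) := by
    simp only [Twist.seg, ContinuousMap.comp_assoc, hH]
    congr 3
    ext i; fin_cases i <;> rfl
  simp only [LinearMap.smul_apply, LinearMap.comp_apply, push_of, TupleChain.map_of,
    smul_smul, Function.comp_apply, hseg, ContinuousMap.comp_assoc, hH]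
  rw [← w.seg_mul_seg G y₀ (H z₀) (H (u 0))]
  push_cast
  rfl

theorem push_comp_lin (G : C(Y, X)) (y₀ : Y) {m : ℕ} (v : Fin (m + 1) → Y)
    (c : TupleChain (Simplex m) (n + 1)) :
    (w.seg G y₀ (v 0) : ℤ) • push w (G.comp (lin v)) (vert 0) n c =
      push w G y₀ n (TupleChain.map (lin v) (n + 1) c) := by
  rw [← push_comp w G y₀ (lin v) (lin_lin v) (vert 0) c, lin_vert]

/-! ### Subdivision of singular chains -/

/-- Barycentric subdivision. -/
def sd (n : ℕ) : Chain X n →ₗ[ℤ] Chain X n :=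
  Finsupp.linearCombination ℤ fun σ => push w σ (vert 0) n (TupleChain.sd bary (n + 1) (taut n))

/-- The homotopy between the identity and barycentric subdivision. -/
def sdHomotopy (n : ℕ) : Chain X n →ₗ[ℤ] Chain X (n + 1) :=
  Finsupp.linearCombination ℤ fun σ =>
    push w σ (vert 0) (n + 1) (TupleChain.sdHomotopy bary (n + 1) (taut n))

theorem sd_of (σ : C(Simplex n, X)) : sd w n (Chain.of σ) =
    push w σ (vert 0) n (TupleChain.sd bary (n + 1) (taut n)) := by
  simp [sd]

theorem sdHomotopy_of (σ : C(Simplex n, X)) : sdHomotopy w n (Chain.of σ) =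
    push w σ (vert 0) (n + 1) (TupleChain.sdHomotopy bary (n + 1) (taut n)) := by
  simp [sdHomotopy]

theorem map_lin_taut (v : Fin (n + 1) → Y) :
    TupleChain.map (lin v) (n + 1) (taut n) = TupleChain.of v := by
  rw [TupleChain.map_of]
  congr 1
  ext i
  simp [lin_vert]

theorem sd_push (G : C(Y, X)) (y₀ : Y) (c : TupleChain Y (n + 1)) :
    sd w n (push w G y₀ n c) = push w G y₀ n (TupleChain.sd bary (n + 1) c) := by
  revert c
  suffices h : (sd w n).comp (push w G y₀ n) =
    (push w G y₀ n).comp (TupleChain.sd bary (n + 1)) from LinearMap.congr_fun h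
  refine TupleChain.hom_ext fun v => ?_
  simp only [LinearMap.comp_apply, push_of, map_smul, sd_of, push_comp_lin]
  rw [TupleChain.map_sd (lin_bary v), map_lin_taut]

theorem sdHomotopy_push (G : C(Y, X)) (y₀ : Y) (c : TupleChain Y (n + 1)) :
    sdHomotopy w n (push w G y₀ n c) =
      push w G y₀ (n + 1) (TupleChain.sdHomotopy bary (n + 1) c) := by
  revert c
  suffices h : (sdHomotopy w n).comp (push w G y₀ n) =
    (push w G y₀ (n + 1)).comp (TupleChain.sdHomotopy bary (n + 1)) from LinearMap.congr_fun h
  refine TupleChain.hom_ext fun v => ?_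
  simp only [LinearMap.comp_apply, push_of, map_smul, sdHomotopy_of, push_comp_lin]
  rw [TupleChain.map_sdHomotopy (lin_bary v), map_lin_taut]

theorem bd_sd (c : Chain X (n + 1)) : bd w n (sd w (n + 1) c) = sd w n (bd w n c) := by
  revert c
  suffices h : (bd w n).comp (sd w (n + 1)) = (sd w n).comp (bd w n) from LinearMap.congr_fun h
  refine Chain.hom_ext fun σ => ?_
  simp only [LinearMap.comp_apply, bd_eq_push, sd_of, bd_push, sd_push, TupleChain.bd_sd]

theorem bd_sdHomotopy (c : Chain X (n + 1)) :
    bd w (n + 1) (sdHomotopy w (n + 1) c) = c - sd w (n + 1) c - sdHomotopy w n (bd w n c) := by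
  revert c
  suffices h : (bd w (n + 1)).comp (sdHomotopy w (n + 1)) =
    LinearMap.id - sd w (n + 1) - (sdHomotopy w n).comp (bd w n) from LinearMap.congr_fun h
  refine Chain.hom_ext fun σ => ?_
  simp only [LinearMap.comp_apply, LinearMap.sub_apply, LinearMap.id_apply, bd_eq_push, sd_of,
    sdHomotopy_of, bd_push, sdHomotopy_push, TupleChain.bd_sdHomotopy, map_sub, push_taut]

end TwistedSingular

/-! ### Iterated subdivision makes simplices small. -/

namespace TwistedSingular

open LocalCoeff (Simplex simplexMap)
open AffineSimplices (lin lin_vert lin_lin)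

/-! ### The mesh of barycentric subdivision -/

theorem map_mem_of_mem_supported {ι M : Type*} [AddCommGroup M] {s : Set ι} {c : ι →₀ ℤ}
    (hc : c ∈ Finsupp.supported ℤ ℤ s) (f : (ι →₀ ℤ) →ₗ[ℤ] M) (N : Submodule ℤ M)
    (h : ∀ i ∈ s, f (Finsupp.single i 1) ∈ N) : f c ∈ N := by
  rw [Finsupp.supported_eq_span_single] at hc
  have : Submodule.span ℤ ((fun i => Finsupp.single i (1 : ℤ)) '' s) ≤ N.comap f := by
    rw [Submodule.span_le]
    rintro _ ⟨i, hi, rfl⟩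
    exact h i hi
  exact this hc

theorem single_mem_supported {ι : Type*} {s : Set ι} {i : ι} (hi : i ∈ s) :
    Finsupp.single i (1 : ℤ) ∈ Finsupp.supported ℤ ℤ s :=
  Finsupp.single_mem_supported ℤ 1 hi

theorem bary_coe {N k : ℕ} (v : Fin (k + 1) → Simplex N) :
    (bary k v).1 = ∑ i, ((k : ℝ) + 1)⁻¹ • (v i).1 := by
  rw [bary, lin_simplex_coe]
  refine Finset.sum_congr rfl fun i _ => ?_
  congr 1
  exact (stdSimplex.barycenter_apply i).trans (by simp)

theorem lin_mem_convexHull {N k : ℕ} (v : Fin (k + 1) → Simplex N) (t : Simplex k) :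
    (lin v t).1 ∈ convexHull ℝ (Set.range fun i => (v i).1) := by
  rw [lin_simplex_coe]
  exact (convex_convexHull ℝ _).sum_mem (fun i _ => t.2.1 i) t.2.2
    fun i _ => subset_convexHull ℝ _ ⟨i, rfl⟩

/-- The difference is the average of the k + 1 vectors from the i-th vertex to the vertices, one of
which is zero. -/
theorem dist_bary_le {N k : ℕ} (v : Fin (k + 1) → Simplex N) {D : ℝ}
    (hD : ∀ i j, dist (v i) (v j) ≤ D) (i : Fin (k + 1)) :
    dist (bary k v).1 (v i).1 ≤ k / (k + 1) * D := by
  have hk : (0 : ℝ) < k + 1 := by positivity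
  have e : (bary k v).1 - (v i).1 = ∑ j, ((k : ℝ) + 1)⁻¹ • ((v j).1 - (v i).1) := by
    simp only [smul_sub, Finset.sum_sub_distrib, bary_coe, Finset.sum_const, Finset.card_univ,
      Fintype.card_fin]
    rw [← Nat.cast_smul_eq_nsmul ℝ, smul_smul]
    push_cast
    rw [mul_inv_cancel₀ hk.ne', one_smul]
  rw [dist_eq_norm, e]
  refine (norm_sum_le _ _).trans ?_
  rw [← Finset.sum_erase (a := i) _ (by simp)]
  refine (Finset.sum_le_card_nsmul _ _ (((k : ℝ) + 1)⁻¹ * D) fun j _ => ?_).trans (le_of_eq ?_)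
  · rw [norm_smul, Real.norm_of_nonneg (by positivity), ← dist_eq_norm]
    exact mul_le_mul_of_nonneg_left (hD j i) (by positivity)
  · simp [Finset.card_erase_of_mem]
    ring

/-- Membership in the convex hull is carried through the induction because distances from the new
apex are controlled on the whole hull as soon as they are at the vertices. -/
theorem sd_of_mem_supported {N : ℕ} {D : ℝ} (hD₀ : 0 ≤ D) : ∀ (k : ℕ) (v : Fin k → Simplex N),
    (∀ i j, dist (v i) (v j) ≤ D) →
    TupleChain.sd bary k (TupleChain.of v) ∈ Finsupp.supported ℤ ℤ
      {u | (∀ i j, dist (u i) (u j) ≤ ((k : ℝ) - 1) / k * D) ∧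
        ∀ i, (u i).1 ∈ convexHull ℝ (Set.range fun i => (v i).1)}
  | 0, v, _ => single_mem_supported ⟨fun i => i.elim0, fun i => i.elim0⟩
  | k + 1, v, hv => by
    rw [TupleChain.sd_succ_of, TupleChain.bd_of]
    simp only [map_sum, map_smul]
    refine Submodule.sum_mem _ fun i _ => Submodule.smul_mem _ _ ?_
    refine map_mem_of_mem_supported
      (sd_of_mem_supported hD₀ k (v ∘ i.succAbove) fun _ _ => hv _ _) _ _ fun u hu => ?_
    rw [TupleChain.cone_of]
    refine single_mem_supported ?_
    have hsub : convexHull ℝ (Set.range fun j => ((v ∘ i.succAbove) j).1) ⊆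
        convexHull ℝ (Set.range fun j => (v j).1) := by
      refine convexHull_mono ?_
      rintro _ ⟨j, rfl⟩
      exact ⟨_, rfl⟩
    have hb (y) (hy : y ∈ convexHull ℝ (Set.range fun j => (v j).1)) :
        dist y (bary k v).1 ≤ k / (k + 1) * D := by
      refine convexHull_min (t := Metric.closedBall (bary k v).1 (k / (k + 1) * D)) ?_
        (convex_closedBall _ _) hy
      rintro _ ⟨j, rfl⟩
      rw [Metric.mem_closedBall, dist_comm]
      exact dist_bary_le v hv j
    have hθ : ((k : ℝ) - 1) / k * D ≤ k / (k + 1) * D := by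
      refine mul_le_mul_of_nonneg_right ?_ hD₀
      -- For k = 0 the left side is −1/0, which is 0 by convention.
      rcases Nat.eq_zero_or_pos k with rfl | hk
      · simp
      · have : (0 : ℝ) < k := by exact_mod_cast hk
        rw [div_le_div_iff₀ this (by positivity)]
        nlinarith
    have hc : (((k + 1 : ℕ) : ℝ) - 1) / ((k + 1 : ℕ) : ℝ) = k / (k + 1) := by push_cast; ring
    rw [Set.mem_ofPred_eq, hc]
    refine ⟨fun p q => ?_, fun p => ?_⟩
    · refine Fin.cases ?_ (fun p => ?_) p <;> refine Fin.cases ?_ (fun q => ?_) q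
      · simp only [dist_self]; positivity
      · simp only [Fin.cons_zero, Fin.cons_succ]
        rw [dist_comm]
        exact hb _ (hsub (hu.2 q))
      · exact hb _ (hsub (hu.2 p))
      · exact (hu.1 p q).trans hθ
    · refine Fin.cases ?_ (fun p => ?_) p
      · exact lin_mem_convexHull v _
      · exact hsub (hu.2 p)

theorem dist_simplex_le_one {N : ℕ} (s t : Simplex N) : dist s t ≤ 1 := by
  rw [Subtype.dist_eq, dist_pi_le_iff zero_le_one]
  intro i
  have h1 := mem_Icc_of_mem_stdSimplex s.2 i
  have h2 := mem_Icc_of_mem_stdSimplex t.2 i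
  exact Real.dist_le_of_mem_Icc_01 h1 h2

theorem sd_pow_taut_mem_supported (n m : ℕ) :
    (TupleChain.sd bary (n + 1) ^ m) (taut n) ∈ Finsupp.supported ℤ ℤ
      {u | ∀ i j, dist (u i) (u j) ≤ ((n : ℝ) / (n + 1)) ^ m} := by
  induction m with
  | zero => exact single_mem_supported fun i j => by simpa using dist_simplex_le_one _ _
  | succ m ih =>
    rw [pow_succ' (TupleChain.sd bary (n + 1)), Module.End.mul_apply]
    refine map_mem_of_mem_supported ih _ _ fun u hu => ?_
    refine Finsupp.supported_mono ?_ (sd_of_mem_supported (by positivity) (n + 1) u hu)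
    rintro u' ⟨h, -⟩
    rw [pow_succ']
    intro i j
    convert h i j using 2
    push_cast; ring

/-! ### Simplices in a subset -/

variable {X : Type*} [TopologicalSpace X]

/-- The singular simplices with image in `A`. -/
def inSet (A : Set X) (n : ℕ) : Set C(Simplex n, X) := {σ | ∀ t, σ t ∈ A}

/-- The singular simplices with image in one of two sets. -/
def small (U V : Set X) (n : ℕ) : Set C(Simplex n, X) := inSet U n ∪ inSet V n

/-- The chains supported on a set of simplices. -/
abbrev supp {n : ℕ} (S : Set C(Simplex n, X)) : Submodule ℤ (Chain X n) :=
  Finsupp.supported ℤ ℤ S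

theorem inSet_mono {A B : Set X} (h : A ⊆ B) (n : ℕ) : inSet A n ⊆ inSet B n :=
  fun _ hσ t => h (hσ t)

variable {Y : Type*} [TopologicalSpace Y] [AffineSimplices Y] (w : Twist X) {n : ℕ}

theorem push_mem_supp {A : Set X} {G : C(Y, X)} (hG : ∀ y, G y ∈ A) (y₀ : Y)
    (c : TupleChain Y (n + 1)) : push w G y₀ n c ∈ supp (inSet A n) := by
  refine map_mem_of_mem_supported (s := Set.univ) (by simp) _ _ fun v _ => ?_
  rw [push_of]
  exact Submodule.smul_mem _ _ (single_mem_supported fun t => hG _)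

theorem bd_mem_supp {A : Set X} {c : Chain X (n + 1)} (hc : c ∈ supp (inSet A (n + 1))) :
    bd w n c ∈ supp (inSet A n) := by
  refine map_mem_of_mem_supported hc _ _ fun σ hσ => ?_
  rw [bd_eq_push]
  exact push_mem_supp w hσ _ _

theorem sd_mem_supp {A : Set X} {c : Chain X n} (hc : c ∈ supp (inSet A n)) :
    sd w n c ∈ supp (inSet A n) := by
  refine map_mem_of_mem_supported hc _ _ fun σ hσ => ?_
  rw [sd_of]
  exact push_mem_supp w hσ _ _

theorem sd_pow_mem_supp {A : Set X} {c : Chain X n} (hc : c ∈ supp (inSet A n)) (m : ℕ) :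
    (sd w n ^ m) c ∈ supp (inSet A n) := by
  induction m with
  | zero => exact hc
  | succ m ih =>
    rw [pow_succ', Module.End.mul_apply]
    exact sd_mem_supp w ih

theorem sdHomotopy_mem_supp {A : Set X} {c : Chain X n} (hc : c ∈ supp (inSet A n)) :
    sdHomotopy w n c ∈ supp (inSet A (n + 1)) := by
  refine map_mem_of_mem_supported hc _ _ fun σ hσ => ?_
  rw [sdHomotopy_of]
  exact push_mem_supp w hσ _ _

theorem sdHomotopy_mem_supp_small {U V : Set X} {c : Chain X n} (hc : c ∈ supp (small U V n)) :
    sdHomotopy w n c ∈ supp (small U V (n + 1)) := by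
  refine map_mem_of_mem_supported hc _ _ ?_
  rintro σ (hσ | hσ)
  · exact Finsupp.supported_mono Set.subset_union_left
      (sdHomotopy_mem_supp w (single_mem_supported hσ))
  · exact Finsupp.supported_mono Set.subset_union_right
      (sdHomotopy_mem_supp w (single_mem_supported hσ))

theorem sd_pow_of (σ : C(Simplex n, X)) (m : ℕ) : (sd w n ^ m) (Chain.of σ) =
    push w σ (vert 0) n ((TupleChain.sd bary (n + 1) ^ m) (taut n)) := by
  induction m with
  | zero => simp [push_taut]
  | succ m ih => rw [pow_succ', Module.End.mul_apply, ih, sd_push, pow_succ', Module.End.mul_apply]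

theorem bd_sd_pow (c : Chain X (n + 1)) (m : ℕ) :
    bd w n ((sd w (n + 1) ^ m) c) = (sd w n ^ m) (bd w n c) := by
  induction m with
  | zero => rfl
  | succ m ih =>
    rw [pow_succ', Module.End.mul_apply, bd_sd, ih, pow_succ', Module.End.mul_apply]

/-- `A` is the union of the relatively open subsets `U` and `V`. -/
structure IsOpenCover (A U V : Set X) : Prop where
  left : ∃ O, IsOpen O ∧ U = A ∩ O
  right : ∃ O, IsOpen O ∧ V = A ∩ O
  subset : A ⊆ U ∪ V

/-- Every simplex becomes small after finitely many subdivisions. -/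
theorem exists_sd_pow_mem_small {A U V : Set X} (h : IsOpenCover A U V) {σ : C(Simplex n, X)}
    (hσ : σ ∈ inSet A n) : ∃ N, ∀ m ≥ N, (sd w n ^ m) (Chain.of σ) ∈ supp (small U V n) := by
  obtain ⟨⟨O₁, hO₁, rfl⟩, ⟨O₂, hO₂, rfl⟩, hA⟩ := h
  obtain ⟨δ, hδ, hball⟩ := lebesgue_number_lemma_of_metric (s := (Set.univ : Set (Simplex n)))
    (c := fun b : Bool => σ ⁻¹' (cond b O₁ O₂)) isCompact_univ
    (by rintro (_ | _); exacts [hO₂.preimage σ.continuous, hO₁.preimage σ.continuous])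
    (fun x _ => by
      rcases hA (hσ x) with h | h
      · exact Set.mem_iUnion.2 ⟨true, h.2⟩
      · exact Set.mem_iUnion.2 ⟨false, h.2⟩)
  -- The mesh shrinks at least by this factor at each subdivision, so it stays below the Lebesgue
  -- number `δ` from some power on.
  have hlt : (n : ℝ) / (n + 1) < 1 := by rw [div_lt_one (by positivity)]; linarith
  obtain ⟨N, hN⟩ := exists_pow_lt_of_lt_one hδ hlt
  refine ⟨N, fun m hm => ?_⟩
  rw [sd_pow_of]
  refine map_mem_of_mem_supported (sd_pow_taut_mem_supported n m) _ _ fun u hu => ?_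
  rw [push_of]
  refine Submodule.smul_mem _ _ (single_mem_supported ?_)
  have hu' (t) : lin u t ∈ Metric.ball (u 0) δ := by
    refine convexHull_min (t := Metric.ball (u 0).1 δ) ?_ (convex_ball _ _)
      (lin_mem_convexHull u t)
    rintro _ ⟨i, rfl⟩
    exact ((hu i 0).trans (pow_le_pow_of_le_one (by positivity) hlt.le hm)).trans_lt hN
  obtain ⟨b, hb⟩ := hball (u 0) trivial
  rcases b with _ | _
  · exact Or.inr fun t => ⟨hσ _, hb (hu' t)⟩
  · exact Or.inl fun t => ⟨hσ _, hb (hu' t)⟩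

end TwistedSingular

/-! ### Restriction to small simplices and deformation. -/

namespace TwistedSingular

open LocalCoeff (Simplex simplexMap)
open AffineSimplices (lin lin_vert lin_lin)

variable {X : Type*} [TopologicalSpace X] (w : Twist X) {n : ℕ}

/-! ### Cocycles and coboundaries on a family of simplices -/

/-- Singular cochains. -/
abbrev Cochain (X : Type*) [TopologicalSpace X] (n : ℕ) : Type _ := Chain X n →ₗ[ℤ] ℤ

/-- The cochains that are cocycles on a family of simplices. -/
def cocycles (S : ∀ n, Set C(Simplex n, X)) (n : ℕ) : Submodule ℤ (Cochain X n) where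
  carrier := {φ | ∀ σ ∈ S (n + 1), φ (bd w n (Chain.of σ)) = 0}
  add_mem' h h' σ hσ := by simp [h σ hσ, h' σ hσ]
  zero_mem' _ _ := rfl
  smul_mem' c φ h σ hσ := by simp [h σ hσ]

/-- The cochains that are coboundaries on a family of simplices. -/
def coboundaries (S : ∀ n, Set C(Simplex n, X)) : (n : ℕ) → Submodule ℤ (Cochain X n)
  | 0 =>
    { carrier := {φ | ∀ σ ∈ S 0, φ (Chain.of σ) = 0}
      add_mem' := fun h h' σ hσ => by simp [h σ hσ, h' σ hσ]
      zero_mem' := fun _ _ => rfl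
      smul_mem' := fun c φ h σ hσ => by simp [h σ hσ] }
  | n + 1 =>
    { carrier := {φ | ∃ ψ : Cochain X n, ∀ σ ∈ S (n + 1),
        φ (Chain.of σ) = ψ (bd w n (Chain.of σ))}
      add_mem' := by
        rintro _ _ ⟨ψ, h⟩ ⟨ψ', h'⟩
        exact ⟨ψ + ψ', fun σ hσ => by simp [h σ hσ, h' σ hσ]⟩
      zero_mem' := ⟨0, fun _ _ => rfl⟩
      smul_mem' := by
        rintro c _ ⟨ψ, h⟩
        exact ⟨c • ψ, fun σ hσ => by simp [h σ hσ]⟩ }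

theorem cocycles_anti {S T : ∀ n, Set C(Simplex n, X)} (h : ∀ n, S n ⊆ T n) (n : ℕ) :
    cocycles w T n ≤ cocycles w S n :=
  fun _ hφ σ hσ => hφ σ (h _ hσ)

variable {w}

theorem eq_on_supp {M : Type*} [AddCommGroup M] {f g : Chain X n →ₗ[ℤ] M}
    {S : Set C(Simplex n, X)} (h : ∀ σ ∈ S, f (Chain.of σ) = g (Chain.of σ)) {c : Chain X n}
    (hc : c ∈ supp S) : f c = g c := by
  have := map_mem_of_mem_supported hc (f - g) ⊥ fun σ hσ => by simp [h σ hσ]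
  simpa [sub_eq_zero] using this

theorem cocycle_bd_eq_zero {S : ∀ n, Set C(Simplex n, X)} {φ : Cochain X n}
    (hφ : φ ∈ cocycles w S n) {c : Chain X (n + 1)} (hc : c ∈ supp (S (n + 1))) :
    φ (bd w n c) = 0 :=
  eq_on_supp (f := φ.comp (bd w n)) (g := 0) hφ hc

/-- Cohomology injects under restriction to the small simplices of an open cover. -/
theorem cocycles_inf_coboundaries_small_le {A U V : Set X} (h : IsOpenCover A U V) (n : ℕ) :
    cocycles w (inSet A) n ⊓ coboundaries w (small U V) n ≤ coboundaries w (inSet A) n := by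
  rintro φ ⟨hφ, hφ'⟩
  rcases n with _ | n
  · intro σ hσ
    refine hφ' σ ?_
    have hs (t : Simplex 0) : σ t = σ (vert 0) := congrArg σ (Subsingleton.elim _ _)
    rcases h.subset (hσ (vert 0)) with h0 | h0
    · exact Or.inl fun t => by rw [hs]; exact h0
    · exact Or.inr fun t => by rw [hs]; exact h0
  obtain ⟨ψ, hψ⟩ := hφ'
  suffices hθ : φ - ψ.comp (bd w n) ∈ coboundaries w (inSet A) (n + 1) by
    obtain ⟨ψ', hψ'⟩ := hθ
    refine ⟨ψ + ψ', fun σ hσ => ?_⟩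
    have := hψ' σ hσ
    simp only [LinearMap.sub_apply, LinearMap.comp_apply] at this
    simp only [LinearMap.add_apply, ← this]
    abel
  have hsmall : ∀ c ∈ supp (small U V (n + 1)), (φ - ψ.comp (bd w n)) c = 0 :=
    fun c hc => eq_on_supp (g := 0) (fun σ hσ => by simp [hψ σ hσ]) hc
  have hcoc : φ - ψ.comp (bd w n) ∈ cocycles w (inSet A) (n + 1) := by
    intro σ hσ
    simp [hφ σ hσ, bd_bd]
  generalize φ - ψ.comp (bd w n) = θ at hsmall hcoc
  clear hψ ψ hφ φ
  -- The sum over all i of these terms is formally a primitive of `θ`. No bound on i works for all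
  -- simplices, but for each simplex in `A` the terms vanish once its subdivision is small, so the
  -- sum is finite simplex by simplex.
  let term (i : ℕ) : Cochain X n := θ.comp ((sdHomotopy w n).comp (sd w n ^ i))
  have hex (τ : C(Simplex n, X)) : ∃ N, τ ∈ inSet A n → ∀ i ≥ N, term i (Chain.of τ) = 0 := by
    by_cases hτ : τ ∈ inSet A n
    · obtain ⟨N, hN⟩ := exists_sd_pow_mem_small w h hτ
      exact ⟨N, fun _ i hi => hsmall _ (sdHomotopy_mem_supp_small w (hN i hi))⟩
    · exact ⟨0, fun h => (hτ h).elim⟩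
  choose N hN using hex
  let ψ : Cochain X n :=
    Finsupp.linearCombination ℤ fun τ => ∑ i ∈ Finset.range (N τ), term i (Chain.of τ)
  have hψ {c : Chain X n} (hc : c ∈ supp (inSet A n)) :
      ∃ M₀, ∀ M ≥ M₀, ψ c = ∑ i ∈ Finset.range M, term i c := by
    rw [supp, Finsupp.supported_eq_span_single] at hc
    induction hc using Submodule.span_induction with
    | mem x hx =>
      obtain ⟨τ, hτ, rfl⟩ := hx
      refine ⟨N τ, fun M hM => ?_⟩
      simp only [ψ, Finsupp.linearCombination_single, one_smul]
      refine Finset.sum_subset (by simpa using hM) fun i _ hi => hN τ hτ i (by simpa using hi)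
    | zero => exact ⟨0, fun M _ => by simp⟩
    | add x y _ _ hx hy =>
      obtain ⟨M₁, h₁⟩ := hx
      obtain ⟨M₂, h₂⟩ := hy
      refine ⟨max M₁ M₂, fun M hM => ?_⟩
      simp only [map_add, Finset.sum_add_distrib]
      rw [h₁ M (le_of_max_le_left hM), h₂ M (le_of_max_le_right hM)]
    | smul a x _ hx =>
      obtain ⟨M₁, h₁⟩ := hx
      refine ⟨M₁, fun M hM => ?_⟩
      simp only [map_smul, ← Finset.smul_sum]
      rw [h₁ M hM]
  refine ⟨ψ, fun σ hσ => ?_⟩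
  have hσ' := single_mem_supported hσ
  obtain ⟨M₁, h₁⟩ := hψ (bd_mem_supp w hσ')
  obtain ⟨M₂, h₂⟩ := exists_sd_pow_mem_small w h hσ
  rw [h₁ (max M₁ M₂) (le_max_left _ _)]
  -- The sum telescopes, leaving `θ` on `σ` minus `θ` on a subdivision fine enough to be small,
  -- where `θ` vanishes.
  have hterm (i : ℕ) : term i (bd w n (Chain.of σ)) =
      θ ((sd w (n + 1) ^ i) (Chain.of σ)) - θ ((sd w (n + 1) ^ (i + 1)) (Chain.of σ)) := by
    have h3 := cocycle_bd_eq_zero hcoc (sdHomotopy_mem_supp w (sd_pow_mem_supp w hσ' i))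
    rw [bd_sdHomotopy, map_sub, map_sub, bd_sd_pow] at h3
    simp only [term, LinearMap.comp_apply, pow_succ', Module.End.mul_apply]
    linarith
  simp only [hterm]
  rw [Finset.sum_range_sub', hsmall _ (h₂ _ (le_max_right _ _))]
  simp

/-! ### Homotopies -/

section homotopy

variable {A : Set X} (F : C(A × unitInterval, X))

/-- The homotopy `F` applied to a simplex in `A`. -/
def homotopySimplex {σ : C(Simplex n, X)} (hσ : σ ∈ inSet A n) :
    C(Simplex n × unitInterval, X) :=
  F.comp ((⟨fun t => ⟨σ t, hσ t⟩, by fun_prop⟩ : C(Simplex n, A)).prodMap (ContinuousMap.id _))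

open Classical in
variable (w) in
/-- The operator on chains in `A` induced by the homotopy `F` and a chain of tuples in the prism. -/
def homotopyOp {m : ℕ} (Θ : TupleChain (Simplex n × unitInterval) (m + 1)) :
    Chain X n →ₗ[ℤ] Chain X m :=
  Finsupp.linearCombination ℤ fun σ =>
    if h : σ ∈ inSet A n then push w (homotopySimplex F h) (vert 0, 0) m Θ else 0

theorem homotopyOp_of {m : ℕ} (Θ : TupleChain (Simplex n × unitInterval) (m + 1))
    {σ : C(Simplex n, X)} (hσ : σ ∈ inSet A n) :
    homotopyOp w F Θ (Chain.of σ) = push w (homotopySimplex F hσ) (vert 0, 0) m Θ := by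
  simp [homotopyOp, hσ]

theorem lin_const {Y : Type*} [TopologicalSpace Y] [AffineSimplices Y] {m : ℕ} (y : Y)
    (t : Simplex m) : lin (fun _ => y) t = y := by
  have h := DFunLike.congr_fun (lin_comp_simplexMap (fun _ : Fin 1 => y) fun _ : Fin (m + 1) => 0) t
  refine h.symm.trans ?_
  rw [ContinuousMap.comp_apply,
    Subsingleton.elim (simplexMap (fun _ : Fin (m + 1) => (0 : Fin 1)) t) (vert 0)]
  exact lin_vert (fun _ : Fin 1 => y) 0

theorem homotopySimplex_comp_lin {σ : C(Simplex n, X)} (hσ : σ ∈ inSet A n) {m : ℕ}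
    (hF : ∀ a : A, F (a, 0) = a) (u : Fin (m + 1) → Simplex n) :
    (homotopySimplex F hσ).comp (lin fun i => (u i, 0)) = σ.comp (lin u) := by
  ext t
  have : lin (fun i => (u i, (0 : unitInterval))) t = (lin u t, 0) :=
    Prod.ext rfl (lin_const 0 t)
  simp only [ContinuousMap.comp_apply, this]
  exact hF _

/-- Since the homotopy starts at the identity, signs along the bottom of the prism are those of `σ`.
Hence the twisted faces of `σ` become the ordinary faces of one prism. -/
theorem homotopyOp_bd {m : ℕ} (Θ : TupleChain (Simplex n × unitInterval) (m + 1))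
    (hF : ∀ a : A, F (a, 0) = a)
    {σ : C(Simplex (n + 1), X)} (hσ : σ ∈ inSet A (n + 1)) :
    homotopyOp w F Θ (bd w n (Chain.of σ)) = push w (homotopySimplex F hσ) (vert 0, 0) m
      (∑ i : Fin (n + 2), (-1 : ℤ) ^ (i : ℕ) •
        TupleChain.map (Prod.map (lin fun j => vert (i.succAbove j)) id) (m + 1) Θ) := by
  simp only [bd_of, map_sum, map_smul]
  refine Finset.sum_congr rfl fun i _ => ?_
  have hi : σ.comp (simplexMap i.succAbove) ∈ inSet A n := fun t => hσ _
  rw [homotopyOp_of F Θ hi, mul_smul]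
  congr 1
  let H : C(Simplex n × unitInterval, Simplex (n + 1) × unitInterval) :=
    (lin fun j => vert (i.succAbove j)).prodMap (ContinuousMap.id _)
  have hH : homotopySimplex F hi = (homotopySimplex F hσ).comp H := by
    ext t
    simp only [homotopySimplex, H, lin_vert_comp]
    rfl
  have hseg : w.seg σ (vert 0) (vert (i.succAbove 0)) =
      w.seg (homotopySimplex F hσ) (vert 0, 0) (H (vert 0, 0)) := by
    have : H (vert 0, 0) = (vert (i.succAbove 0), 0) :=
      Prod.ext (lin_vert (fun j => vert (i.succAbove j)) 0) rfl
    rw [this, Twist.seg, Twist.seg, ← homotopySimplex_comp_lin F hσ hF]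
    congr 3
    ext j : 1
    fin_cases j <;> rfl
  rw [hH, hseg]
  refine push_comp w (homotopySimplex F hσ) (vert 0, 0) H (fun u => ?_) (vert 0, 0) Θ
  ext t : 1
  exact Prod.ext (DFunLike.congr_fun (lin_lin _ (Prod.fst ∘ u)) t) rfl

/-- Cohomology injects under restriction to a subset into which the space can be deformed. -/
theorem cocycles_inf_coboundaries_le_of_homotopy {B : Set X} (hFA : ∀ p, F p ∈ A)
    (hF₀ : ∀ a : A, F (a, 0) = a) (hF₁ : ∀ a : A, F (a, 1) ∈ B) (n : ℕ) :
    cocycles w (inSet A) n ⊓ coboundaries w (inSet B) n ≤ coboundaries w (inSet A) n := by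
  rintro φ ⟨hφ, hφ'⟩
  let h (n : ℕ) : Chain X n →ₗ[ℤ] Chain X (n + 1) :=
    homotopyOp w F (TupleChain.prism 0 1 (n + 1) (taut n))
  let ρ (n : ℕ) : Chain X n →ₗ[ℤ] Chain X n :=
    homotopyOp w F (TupleChain.map (·, (1 : unitInterval)) (n + 1) (taut n))
  have hh {n : ℕ} {σ : C(Simplex n, X)} (hσ : σ ∈ inSet A n) :
      h n (Chain.of σ) ∈ supp (inSet A (n + 1)) := by
    rw [show h n _ = _ from homotopyOp_of F _ hσ]
    exact push_mem_supp w (G := homotopySimplex F hσ) (fun y => hFA _) _ _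
  have hρ {n : ℕ} {σ : C(Simplex n, X)} (hσ : σ ∈ inSet A n) :
      ρ n (Chain.of σ) ∈ supp (inSet B n) := by
    rw [show ρ n _ = _ from homotopyOp_of F _ hσ, TupleChain.map_of, push_of]
    refine Submodule.smul_mem _ _ (single_mem_supported fun t => ?_)
    have : lin ((fun x => (x, (1 : unitInterval))) ∘ fun i : Fin (n + 1) => vert i) t =
      (lin (fun i => vert i) t, 1) := Prod.ext rfl (lin_const 1 t)
    simp only [ContinuousMap.comp_apply, this]
    exact hF₁ _
  have hbd {n : ℕ} {σ : C(Simplex n, X)} (hσ : σ ∈ inSet A n) :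
      bd w n (h n (Chain.of σ)) = ρ n (Chain.of σ) - Chain.of σ -
        push w (homotopySimplex F hσ) (vert 0, 0) n
          (TupleChain.prism 0 1 n (TupleChain.bd n (taut n))) := by
    rw [show h n _ = _ from homotopyOp_of F _ hσ, show ρ n _ = _ from homotopyOp_of F _ hσ,
      bd_push, TupleChain.bd_prism, map_sub, map_sub]
    congr 2
    rw [TupleChain.map_of, push_of]
    have := homotopySimplex_comp_lin F hσ hF₀ fun i => vert i
    rw [lin_vert_eq_id] at this
    simp only [Function.comp_apply, Twist.seg_self, Units.val_one, one_smul]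
    congr 1
  rcases n with _ | n
  · intro σ hσ
    have h1 := cocycle_bd_eq_zero hφ (hh hσ)
    have h2 : φ (ρ 0 (Chain.of σ)) = 0 := eq_on_supp (g := 0) hφ' (hρ hσ)
    rw [hbd hσ] at h1
    simp only [TupleChain.prism, LinearMap.zero_apply, map_zero, sub_zero, map_sub, h2] at h1
    linarith
  · obtain ⟨ψ, hψ⟩ := hφ'
    have hhb {σ : C(Simplex (n + 1), X)} (hσ : σ ∈ inSet A (n + 1)) :
        h n (bd w n (Chain.of σ)) = push w (homotopySimplex F hσ) (vert 0, 0) (n + 1)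
          (TupleChain.prism 0 1 (n + 1) (TupleChain.bd (n + 1) (taut (n + 1)))) := by
      rw [show h n _ = _ from homotopyOp_bd F _ hF₀ hσ]
      simp only [TupleChain.bd_of, map_sum, map_smul]
      refine Finset.sum_congr rfl fun i _ => ?_
      rw [TupleChain.map_prism, map_lin_taut]
      rfl
    have hρb {σ : C(Simplex (n + 1), X)} (hσ : σ ∈ inSet A (n + 1)) :
        bd w n (ρ (n + 1) (Chain.of σ)) = ρ n (bd w n (Chain.of σ)) := by
      rw [show ρ n _ = _ from homotopyOp_bd F _ hF₀ hσ,
        show ρ (n + 1) _ = _ from homotopyOp_of F _ hσ, bd_push, TupleChain.bd_map]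
      simp only [TupleChain.bd_of, map_sum, map_smul]
      refine Finset.sum_congr rfl fun i _ => ?_
      rw [TupleChain.map_of, TupleChain.map_of, TupleChain.map_of]
      congr 3
      ext j : 1
      exact Prod.ext (lin_vert (fun j => vert (i.succAbove j)) j).symm rfl
    -- From ∂h + h∂ = ρ − 1 and φ∂ = 0 on `A`, one gets φ = φρ − φh∂, and φρ = ψ∂ρ = ψρ∂.
    refine ⟨ψ.comp (ρ n) - φ.comp (h n), fun σ hσ => ?_⟩
    have h1 := cocycle_bd_eq_zero hφ (hh hσ)
    have h2 : φ (ρ (n + 1) (Chain.of σ)) = ψ (bd w n (ρ (n + 1) (Chain.of σ))) :=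
      eq_on_supp (g := ψ.comp (bd w n)) hψ (hρ hσ)
    rw [hbd hσ, ← hhb hσ, map_sub, map_sub, h2, hρb hσ] at h1
    simp only [LinearMap.sub_apply, LinearMap.comp_apply]
    linarith

end homotopy

end TwistedSingular

/-! ### Mayer-Vietoris and finiteness of cohomology. -/

namespace TwistedSingular

open LocalCoeff (Simplex simplexMap)
open AffineSimplices (lin lin_vert lin_lin)

variable {X : Type*} [TopologicalSpace X] {w : Twist X} {n : ℕ}

/-! ### The Mayer-Vietoris connecting map -/

open Classical in
/-- The projection of chains onto the chains supported on a set of simplices. -/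
def proj (S : Set C(Simplex n, X)) : Chain X n →ₗ[ℤ] Chain X n :=
  Finsupp.linearCombination ℤ fun σ => if σ ∈ S then Chain.of σ else 0

theorem proj_of_mem {S : Set C(Simplex n, X)} {σ : C(Simplex n, X)} (h : σ ∈ S) :
    proj S (Chain.of σ) = Chain.of σ := by simp [proj, h]

theorem proj_of_notMem {S : Set C(Simplex n, X)} {σ : C(Simplex n, X)} (h : σ ∉ S) :
    proj S (Chain.of σ) = 0 := by simp [proj, h]

theorem proj_eq_self {S : Set C(Simplex n, X)} {c : Chain X n} (h : c ∈ supp S) : proj S c = c :=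
  eq_on_supp (g := LinearMap.id) (fun _ hσ => proj_of_mem hσ) h

variable (w) in
/-- The connecting map of the Mayer-Vietoris sequence on cochains. -/
def connecting (U V : Set X) (n : ℕ) : Cochain X n →ₗ[ℤ] Cochain X (n + 1) :=
  LinearMap.lcomp ℤ ℤ ((proj (inSet V n)).comp ((bd w n).comp (proj (inSet U (n + 1)))))

variable {U V : Set X}

theorem connecting_of_mem (χ : Cochain X n) {σ : C(Simplex (n + 1), X)}
    (hσ : σ ∈ inSet U (n + 1)) :
    connecting w U V n χ (Chain.of σ) = χ (proj (inSet V n) (bd w n (Chain.of σ))) := by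
  simp [connecting, proj_of_mem hσ]

theorem connecting_of_notMem (χ : Cochain X n) {σ : C(Simplex (n + 1), X)}
    (hσ : σ ∉ inSet U (n + 1)) : connecting w U V n χ (Chain.of σ) = 0 := by
  simp [connecting, proj_of_notMem hσ]

/-- The connecting cochain is, on `U`, the coboundary of `χ` extended by zero off `V`. On simplices
of `U ∩ V` this is the coboundary of `χ` itself, hence zero. -/
theorem connecting_of_mem_right {χ : Cochain X n} (hχ : χ ∈ cocycles w (inSet (U ∩ V)) n)
    {σ : C(Simplex (n + 1), X)} (hσ : σ ∈ inSet V (n + 1)) :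
    connecting w U V n χ (Chain.of σ) = 0 := by
  by_cases hU : σ ∈ inSet U (n + 1)
  · rw [connecting_of_mem χ hU, proj_eq_self (bd_mem_supp w (single_mem_supported hσ))]
    exact hχ σ fun t => ⟨hU t, hσ t⟩
  · exact connecting_of_notMem χ hU

/-- Exactness at H(A): primitives on `U` and on `V` differ by a cocycle `χ` on `U ∩ V`. Subtracting
from the first its difference `χ`, cut off to `V`, gives one primitive for both pieces. -/
theorem exists_sub_connecting_mem {φ : Cochain X (n + 1)}
    (hU : φ ∈ coboundaries w (inSet U) (n + 1)) (hV : φ ∈ coboundaries w (inSet V) (n + 1)) :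
    ∃ χ ∈ cocycles w (inSet (U ∩ V)) n,
      φ - connecting w U V n χ ∈ coboundaries w (small U V) (n + 1) := by
  obtain ⟨ψ₁, h₁⟩ := hU
  obtain ⟨ψ₂, h₂⟩ := hV
  have hχ : ψ₁ - ψ₂ ∈ cocycles w (inSet (U ∩ V)) n := fun σ hσ => by
    simp [← h₁ σ fun t => (hσ t).1, ← h₂ σ fun t => (hσ t).2]
  refine ⟨ψ₁ - ψ₂, hχ, ψ₁ - (ψ₁ - ψ₂).comp (proj (inSet V n)), ?_⟩
  rintro σ (hσ | hσ)
  · rw [LinearMap.sub_apply, connecting_of_mem _ hσ, h₁ σ hσ]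
    rfl
  · rw [LinearMap.sub_apply, connecting_of_mem_right hχ hσ, h₂ σ hσ, LinearMap.sub_apply,
      LinearMap.comp_apply, proj_eq_self (bd_mem_supp w (single_mem_supported hσ))]
    simp

theorem connecting_mem_coboundaries {χ : Cochain X n} (hχ : χ ∈ cocycles w (inSet (U ∩ V)) n)
    (h : χ ∈ coboundaries w (inSet (U ∩ V)) n) :
    connecting w U V n χ ∈ coboundaries w (small U V) (n + 1) := by
  rcases n with _ | n
  · refine ⟨0, ?_⟩
    rintro σ (hσ | hσ)
    · rw [connecting_of_mem _ hσ]
      refine eq_on_supp (f := χ.comp (proj (inSet V 0))) (g := 0) (fun τ hτ => ?_)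
        (bd_mem_supp w (single_mem_supported hσ))
      by_cases hV : τ ∈ inSet V 0
      · simpa [proj_of_mem hV] using h τ fun t => ⟨hτ t, hV t⟩
      · simp [proj_of_notMem hV]
    · exact connecting_of_mem_right hχ hσ
  · obtain ⟨μ, hμ⟩ := h
    -- If χ = μ∂ on `U ∩ V`, extending `χ` and `μ` by zero off `V` gives a cochain on `U` that
    -- vanishes on simplices of `U ∩ V`, so it may be extended by zero to `V`. On `U` the `μ` term
    -- drops out because ∂∂ = 0.
    refine ⟨(χ.comp (proj (inSet V (n + 1))) -
      μ.comp ((proj (inSet V n)).comp (bd w n))).comp (proj (inSet U (n + 1))), ?_⟩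
    rintro σ (hσ | hσ)
    · rw [connecting_of_mem _ hσ, LinearMap.comp_apply,
        proj_eq_self (bd_mem_supp w (single_mem_supported hσ))]
      simp [bd_bd]
    · rw [connecting_of_mem_right hχ hσ]
      refine (eq_on_supp (g := 0) (fun τ hτ => ?_)
        (bd_mem_supp w (single_mem_supported hσ))).symm
      by_cases hU : τ ∈ inSet U (n + 1)
      · simp only [LinearMap.comp_apply, LinearMap.sub_apply, proj_of_mem hU, proj_of_mem hτ,
          proj_eq_self (bd_mem_supp w (single_mem_supported hτ)), hμ τ fun t => ⟨hU t, hτ t⟩]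
        simp
      · simp [proj_of_notMem hU]

/-! ### Bounds on cohomology -/

theorem coboundaries_le_cocycles (A : Set X) (n : ℕ) :
    coboundaries w (inSet A) n ≤ cocycles w (inSet A) n := by
  intro φ hφ σ hσ
  have hσ' := bd_mem_supp w (single_mem_supported hσ)
  rcases n with _ | n
  · exact eq_on_supp (g := 0) hφ hσ'
  · obtain ⟨ψ, hψ⟩ := hφ
    rw [eq_on_supp (g := ψ.comp (bd w n)) hψ hσ', LinearMap.comp_apply, bd_bd, map_zero]

/-- A submodule is finitely generated modulo `B` if this is so for its image under a linear map
and for its intersection with the kernel. -/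
theorem exists_fg_of_map {R M N : Type*} [Ring R] [AddCommGroup M] [Module R M] [AddCommGroup N]
    [Module R N] {Z B F : Submodule R M} (hF : F.FG) (f : M →ₗ[R] N) (hf : (Z.map f).FG)
    (h : Z ⊓ LinearMap.ker f ≤ F ⊔ B) : ∃ F' : Submodule R M, F'.FG ∧ Z ≤ F' ⊔ B := by
  obtain ⟨F₁, hF₁, hle, he⟩ : ∃ F₁ : Submodule R M, F₁.FG ∧ F₁ ≤ Z ∧ F₁.map f = Z.map f := by
    obtain ⟨s, hs⟩ := hf
    have hsub : (s : Set N) ⊆ f '' Z := by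
      rw [← Submodule.map_coe, ← hs]; exact Submodule.subset_span
    obtain ⟨t, ht, hts⟩ := (Set.exists_subset_image_finite_and (s := (Z : Set M)) (f := f)
      (p := fun u => u = (s : Set N))).1 ⟨s, hsub, s.finite_toSet, rfl⟩
    refine ⟨Submodule.span R t, Submodule.fg_span hts.1, Submodule.span_le.2 ht, ?_⟩
    rw [Submodule.map_span, hts.2, hs]
  refine ⟨F₁ ⊔ F, hF₁.sup hF, fun z hz => ?_⟩
  obtain ⟨z₁, hz₁, e⟩ : f z ∈ F₁.map f := he ▸ Submodule.mem_map_of_mem hz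
  have : z - z₁ ∈ F ⊔ B := h ⟨Z.sub_mem hz (hle hz₁), by simp [e]⟩
  rw [← add_sub_cancel z₁ z, sup_assoc]
  exact Submodule.add_mem_sup hz₁ this

theorem fg_map_mkQ {R M : Type*} [Ring R] [IsNoetherianRing R] [AddCommGroup M] [Module R M]
    {Z B F : Submodule R M} (hF : F.FG) (h : Z ≤ F ⊔ B) : (Z.map B.mkQ).FG := by
  refine (hF.map B.mkQ).of_le ?_
  refine (Submodule.map_mono h).trans ?_
  rw [Submodule.map_sup]
  simp

variable (w) in
/-- The twisted cohomology of `A` is finitely generated and vanishes in degrees at least `d`. -/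
structure CohomologyBound (A : Set X) (d : ℕ) : Prop where
  fg (n : ℕ) : ∃ F : Submodule ℤ (Cochain X n), F.FG ∧
    cocycles w (inSet A) n ≤ F ⊔ coboundaries w (inSet A) n
  vanish (n : ℕ) : d ≤ n → cocycles w (inSet A) n ≤ coboundaries w (inSet A) n

namespace CohomologyBound

variable {A B : Set X} {d : ℕ}

theorem mono (h : CohomologyBound w A d) {d' : ℕ} (hd : d ≤ d') : CohomologyBound w A d' :=
  ⟨h.fg, fun n hn => h.vanish n (hd.trans hn)⟩

/-- Injectivity of restriction to `B` suffices, so the homotopy need not keep `B` fixed or inside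
itself. -/
theorem of_homotopy (h : CohomologyBound w B d) (hBA : B ⊆ A) (F : C(A × unitInterval, X))
    (hFA : ∀ p, F p ∈ A) (hF₀ : ∀ a : A, F (a, 0) = a) (hF₁ : ∀ a : A, F (a, 1) ∈ B) :
    CohomologyBound w A d := by
  have hZ := cocycles_anti w fun n => inSet_mono hBA n
  have hB (n) := cocycles_inf_coboundaries_le_of_homotopy (w := w) F hFA hF₀ hF₁ n
  refine ⟨fun n => ?_, fun n hn => ?_⟩
  · obtain ⟨G, hG, hle⟩ := h.fg n
    refine exists_fg_of_map Submodule.fg_bot (coboundaries w (inSet B) n).mkQ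
      (fg_map_mkQ hG ((hZ n).trans hle)) ?_
    rw [Submodule.ker_mkQ, bot_sup_eq]
    exact hB n
  · exact (le_inf le_rfl ((hZ n).trans (h.vanish n hn))).trans (hB n)

theorem empty : CohomologyBound w (∅ : Set X) 0 := by
  have (n : ℕ) : cocycles w (inSet (∅ : Set X)) n ≤ coboundaries w (inSet (∅ : Set X)) n := by
    intro φ _
    rcases n with _ | n
    · exact fun σ hσ => (hσ (vert 0)).elim
    · exact ⟨0, fun σ hσ => (hσ (vert 0)).elim⟩
  exact ⟨fun n => ⟨⊥, Submodule.fg_bot, by simpa using this n⟩, fun n _ => this n⟩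

/-- A class on `A` that dies on `U` and `V` comes from `U ∩ V` one degree lower, whence the shift
from `d` to `d + 1`. -/
theorem mayerVietoris (hA : IsOpenCover A U V) (hU : CohomologyBound w U (d + 1))
    (hV : CohomologyBound w V (d + 1)) (hUV : CohomologyBound w (U ∩ V) d) :
    CohomologyBound w A (d + 1) := by
  have hUA : U ⊆ A := by
    obtain ⟨O, -, rfl⟩ := hA.left; exact Set.inter_subset_left
  have hVA : V ⊆ A := by
    obtain ⟨O, -, rfl⟩ := hA.right; exact Set.inter_subset_left
  have hZU := cocycles_anti w fun n => inSet_mono hUA n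
  have hZV := cocycles_anti w fun n => inSet_mono hVA n
  have hB (n) := cocycles_inf_coboundaries_small_le (w := w) hA n
  refine ⟨fun n => ?_, fun n hn => ?_⟩
  · obtain ⟨FU, hFU, hU⟩ := hU.fg n
    obtain ⟨FV, hFV, hV⟩ := hV.fg n
    let f := (coboundaries w (inSet U) n).mkQ.prod (coboundaries w (inSet V) n).mkQ
    have hf : ((cocycles w (inSet A) n).map f).FG := by
      refine ((fg_map_mkQ hFU ((hZU n).trans hU)).prod (fg_map_mkQ hFV ((hZV n).trans hV))).of_le ?_
      rintro _ ⟨z, hz, rfl⟩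
      exact ⟨Submodule.mem_map_of_mem hz, Submodule.mem_map_of_mem hz⟩
    have hker (φ : Cochain X n) (hφ : φ ∈ LinearMap.ker f) :
        φ ∈ coboundaries w (inSet U) n ∧ φ ∈ coboundaries w (inSet V) n := by
      simpa [f, Prod.ext_iff] using hφ
    rcases n with _ | n
    · refine exists_fg_of_map Submodule.fg_bot f hf ?_
      rintro φ ⟨h, hk⟩
      refine Submodule.mem_sup_right (hB 0 ⟨h, ?_⟩)
      rintro σ (hσ | hσ)
      exacts [(hker φ hk).1 σ hσ, (hker φ hk).2 σ hσ]
    · obtain ⟨F, hF, hUV⟩ := hUV.fg n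
      -- Finiteness is first shown modulo coboundaries on small simplices, then lifted to `A` by the
      -- subdivision argument.
      obtain ⟨F', hF', hle⟩ : ∃ F', F'.FG ∧
          cocycles w (inSet A) (n + 1) ≤ F' ⊔ coboundaries w (small U V) (n + 1) := by
        refine exists_fg_of_map (hF.map (connecting w U V n)) f hf ?_
        rintro φ ⟨-, hk⟩
        obtain ⟨χ, hχ, h⟩ := exists_sub_connecting_mem (hker φ hk).1 (hker φ hk).2
        obtain ⟨x, hx, b, hb, rfl⟩ := Submodule.mem_sup.1 (hUV hχ)
        have hb' := connecting_mem_coboundaries (coboundaries_le_cocycles _ n hb) hb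
        refine Submodule.mem_sup.2 ⟨_, Submodule.mem_map_of_mem hx, _, add_mem h hb', ?_⟩
        rw [map_add]
        abel
      refine exists_fg_of_map Submodule.fg_bot (coboundaries w (small U V) (n + 1)).mkQ
        (fg_map_mkQ hF' hle) ?_
      rw [Submodule.ker_mkQ, bot_sup_eq]
      exact hB _
  · obtain ⟨n, rfl⟩ : ∃ m, n = m + 1 := ⟨n - 1, by omega⟩
    intro φ hφ
    refine hB _ ⟨hφ, ?_⟩
    obtain ⟨χ, hχ, h⟩ := exists_sub_connecting_mem (hU.vanish _ hn (hZU _ hφ))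
      (hV.vanish _ hn (hZV _ hφ))
    simpa using add_mem h (connecting_mem_coboundaries hχ (hUV.vanish n (by omega) hχ))

/-- There is one simplex in each degree, and its boundary is alternately zero and the simplex below.
-/
theorem singleton (c : X) : CohomologyBound w {c} 1 := by
  have hmem (n : ℕ) {σ : C(Simplex n, X)} : σ ∈ inSet {c} n ↔ σ = ContinuousMap.const _ c :=
    ⟨fun h => ContinuousMap.ext h, by rintro rfl; exact fun _ => rfl⟩
  have hbd (n : ℕ) : bd w n (Chain.of (ContinuousMap.const _ c)) =
      (if Even (n + 2) then 0 else 1 : ℤ) • Chain.of (ContinuousMap.const _ c) := by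
    rw [bd_of, ← Fin.sum_neg_one_pow, Finset.sum_smul]
    refine Finset.sum_congr rfl fun i _ => ?_
    have : w.seg (ContinuousMap.const (Simplex (n + 1)) c) (vert 0) (vert (i.succAbove 0)) = 1 :=
      w.seg_self (ContinuousMap.const (Simplex (n + 1)) c) (vert 0)
    rw [this, Units.val_one, mul_one]
    rfl
  have hv (n : ℕ) (hn : 1 ≤ n) : cocycles w (inSet {c}) n ≤ coboundaries w (inSet {c}) n := by
    obtain ⟨n, rfl⟩ : ∃ m, n = m + 1 := ⟨n - 1, by omega⟩
    intro φ hφ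
    have h0 := hφ _ ((hmem _).2 rfl)
    rw [hbd, map_smul] at h0
    refine ⟨Finsupp.linearCombination ℤ fun _ => φ (Chain.of (ContinuousMap.const _ c)),
      fun σ hσ => ?_⟩
    rw [(hmem _).1 hσ, hbd]
    by_cases hn : Even (n + 2)
    · rw [if_neg (by grind), one_smul] at h0
      rw [h0, if_pos hn, zero_smul, map_zero]
    · simp [hn]
  refine ⟨fun n => ?_, hv⟩
  rcases n with _ | n
  · refine ⟨Submodule.span ℤ {Finsupp.linearCombination ℤ fun _ => 1},
      Submodule.fg_span_singleton _, fun φ _ => Submodule.mem_sup.2 ⟨_, Submodule.smul_mem _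
        (φ (Chain.of (ContinuousMap.const _ c))) (Submodule.mem_span_singleton_self _),
        _, ?_, add_sub_cancel _ _⟩⟩
    intro σ hσ
    rw [(hmem _).1 hσ]
    simp
  · exact ⟨⊥, Submodule.fg_bot, by simpa using hv (n + 1) (by omega)⟩

/-- A disjoint union of two relatively open subsets. -/
theorem disjoint_union (hA : IsOpenCover A U V) (hUV : U ∩ V = ∅) (hU : CohomologyBound w U 1)
    (hV : CohomologyBound w V 1) : CohomologyBound w A 1 :=
  mayerVietoris hA hU hV (hUV ▸ empty)

/-- A set contractible to one of its points. -/
theorem of_contraction {c : X} (hc : c ∈ A) (F : C(A × unitInterval, X))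
    (hFA : ∀ p, F p ∈ A) (hF₀ : ∀ a : A, F (a, 0) = a) (hF₁ : ∀ a : A, F (a, 1) = c) :
    CohomologyBound w A 1 :=
  (singleton c).of_homotopy (by simpa using hc) F hFA hF₀ hF₁

end CohomologyBound
end TwistedSingular

/-! ### Induction over the cells of a finite complex. -/

namespace TwistedSingular

variable {X : Type*} [TopologicalSpace X] {w : Twist X}

/-! ### Subsets of an open cell -/

section openCover

variable {E : Type*} [TopologicalSpace E] {e : PartialEquiv E X}

theorem exists_isOpen_image_inter (hs : ContinuousOn e.symm e.target) {Q O : Set E}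
    (hQ : Q ⊆ e.source) (hO : IsOpen O) :
    ∃ O', IsOpen O' ∧ e '' (Q ∩ O) = e '' Q ∩ O' := by
  obtain ⟨u, hu, h⟩ := continuousOn_iff'.1 hs O hO
  refine ⟨u, hu, ?_⟩
  have key {y : E} (hy : y ∈ Q) : y ∈ O ↔ e y ∈ u := by
    have ht := e.map_source (hQ hy)
    have := Set.ext_iff.1 h (e y)
    simpa [ht, e.left_inv (hQ hy)] using this
  ext x
  constructor
  · rintro ⟨y, ⟨hy, hyO⟩, rfl⟩
    exact ⟨⟨y, hy, rfl⟩, (key hy).1 hyO⟩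
  · rintro ⟨⟨y, hy, rfl⟩, hyu⟩
    exact ⟨y, ⟨hy, (key hy).2 hyu⟩, rfl⟩

theorem isOpenCover_image (hs : ContinuousOn e.symm e.target) {Q O₁ O₂ : Set E}
    (hQ : Q ⊆ e.source) (h₁ : IsOpen O₁) (h₂ : IsOpen O₂) (h : Q ⊆ O₁ ∪ O₂) :
    IsOpenCover (e '' Q) (e '' (Q ∩ O₁)) (e '' (Q ∩ O₂)) where
  left := exists_isOpen_image_inter hs hQ h₁
  right := exists_isOpen_image_inter hs hQ h₂
  subset := by
    rw [← Set.image_union, ← Set.inter_union_distrib_left, Set.inter_eq_left.2 h]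

end openCover

section chart

variable {E : Type*} [NormedAddCommGroup E] [NormedSpace ℝ E] {e : PartialEquiv E X}

theorem CohomologyBound.image_of_starConvex (he : ContinuousOn e e.source)
    (hs : ContinuousOn e.symm e.target) {Q : Set E} (hQ : Q ⊆ e.source) {q : E} (hq : q ∈ Q)
    (hstar : StarConvex ℝ q Q) : CohomologyBound w (e '' Q) 1 := by
  have hsymm (a : e '' Q) : e.symm a.1 ∈ Q := by
    obtain ⟨_, y, hy, rfl⟩ := a
    simpa [e.left_inv (hQ hy)] using hy
  have hmem (p : (e '' Q) × unitInterval) :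
      AffineMap.lineMap (e.symm p.1.1) q (p.2 : ℝ) ∈ Q := by
    rw [AffineMap.lineMap_apply_module, add_comm]
    exact hstar (hsymm p.1) p.2.2.1 (by linarith [p.2.2.2]) (by ring)
  have hsc : Continuous fun a : e '' Q => e.symm a.1 :=
    hs.comp_continuous continuous_subtype_val fun a => by
      obtain ⟨_, y, hy, rfl⟩ := a
      exact e.map_source (hQ hy)
  have hcont : Continuous fun p : (e '' Q) × unitInterval =>
      e (AffineMap.lineMap (e.symm p.1.1) q (p.2 : ℝ)) := by
    refine he.comp_continuous ?_ fun p => hQ (hmem p)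
    simp only [AffineMap.lineMap_apply_module]
    exact ((continuous_const.sub (continuous_subtype_val.comp continuous_snd)).smul
      (hsc.comp continuous_fst)).add
        ((continuous_subtype_val.comp continuous_snd).smul continuous_const)
  refine CohomologyBound.of_contraction (Set.mem_image_of_mem e hq) ⟨_, hcont⟩
    (fun p => Set.mem_image_of_mem e (hmem p)) (fun a => ?_) fun a => ?_
  · obtain ⟨_, y, hy, rfl⟩ := a
    simp [e.left_inv (hQ hy)]
  · simp

/-- The image of the part of a convex set off a hyperplane. -/
theorem CohomologyBound.image_off_hyperplane (he : ContinuousOn e e.source)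
    (hs : ContinuousOn e.symm e.target) {Q : Set E} (hQ : Q ⊆ e.source) (hconv : Convex ℝ Q)
    (f : E →L[ℝ] ℝ) {p m : E} (hp : p ∈ Q) (hm : m ∈ Q) (hfp : 0 < f p) (hfm : f m < 0) :
    CohomologyBound w (e '' (Q ∩ {y | f y ≠ 0})) 1 := by
  have hpos : IsOpen {y | 0 < f y} := isOpen_lt continuous_const f.continuous
  have hneg : IsOpen {y | f y < 0} := isOpen_lt f.continuous continuous_const
  have hQ' : Q ∩ {y | f y ≠ 0} ⊆ e.source := Set.inter_subset_left.trans hQ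
  have e₁ : Q ∩ {y | f y ≠ 0} ∩ {y | 0 < f y} = Q ∩ {y | 0 < f y} := by
    ext y; simp +contextual [ne_of_gt]
  have e₂ : Q ∩ {y | f y ≠ 0} ∩ {y | f y < 0} = Q ∩ {y | f y < 0} := by
    ext y; simp +contextual [ne_of_lt]
  have hcov := isOpenCover_image hs hQ' hpos hneg fun y hy => (lt_or_gt_of_ne hy.2).symm
  rw [e₁, e₂] at hcov
  refine .disjoint_union hcov ?_ ?_ ?_
  · rw [← Set.subset_empty_iff]
    rintro _ ⟨⟨y, ⟨hy, h⟩, rfl⟩, ⟨z, ⟨hz, h'⟩, hyz⟩⟩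
    have := e.injOn (hQ hz) (hQ hy) hyz
    subst this
    exact lt_asymm (show 0 < f z from h) h'
  · exact .image_of_starConvex he hs (Set.inter_subset_left.trans hQ) ⟨hp, hfp⟩
      ((hconv.inter (convex_halfSpace_gt f.isLinear 0)).starConvex ⟨hp, hfp⟩)
  · exact .image_of_starConvex he hs (Set.inter_subset_left.trans hQ) ⟨hm, hfm⟩
      ((hconv.inter (convex_halfSpace_lt f.isLinear 0)).starConvex ⟨hm, hfm⟩)

end chart

/-- The punctured open cell of dimension at most two. -/
theorem CohomologyBound.image_punctured_ball {n : ℕ} (hn : n ≤ 2)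
    {e : PartialEquiv (Fin n → ℝ) X} (hsrc : e.source = Metric.ball 0 1)
    (he : ContinuousOn e e.source) (hs : ContinuousOn e.symm e.target) :
    CohomologyBound w (e '' (Metric.ball 0 1 \ {0})) n := by
  have hconv : Convex ℝ (Metric.ball (0 : Fin n → ℝ) 1) := convex_ball 0 1
  have hball {y : Fin n → ℝ} : y ∈ Metric.ball (0 : Fin n → ℝ) 1 ↔ ∀ i, |y i| < 1 := by
    rw [mem_ball_zero_iff, pi_norm_lt_iff one_pos]; rfl
  obtain rfl | rfl | rfl : n = 0 ∨ n = 1 ∨ n = 2 := by omega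
  · have : Metric.ball (0 : Fin 0 → ℝ) 1 \ {0} = ∅ := by
      ext y; simp [Subsingleton.elim y 0]
    rw [this, Set.image_empty]
    exact .empty
  · have : Metric.ball (0 : Fin 1 → ℝ) 1 \ {0} = Metric.ball (0 : Fin 1 → ℝ) 1 ∩
        {y | ContinuousLinearMap.proj (R := ℝ) (φ := fun _ : Fin 1 => ℝ) 0 y ≠ 0} := by
      ext y
      simp [funext_iff]
    rw [this]
    exact .image_off_hyperplane he hs hsrc.ge hconv _ (p := fun _ => 1 / 2) (m := fun _ => -1 / 2)
      (hball.2 fun _ => by norm_num [abs_lt]) (hball.2 fun _ => by norm_num [abs_lt])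
      (by norm_num) (by norm_num)
  · set B := Metric.ball (0 : Fin 2 → ℝ) 1
    have hsub : B \ {0} ⊆ e.source := hsrc ▸ Set.sdiff_subset
    have c0 : Continuous fun y : Fin 2 → ℝ => y 0 := continuous_apply 0
    have c1 : Continuous fun y : Fin 2 → ℝ => y 1 := continuous_apply 1
    -- For s = ±1 this is the plane slit along the closed ray from the origin opposite to s. The
    -- slit ball is star-shaped about (s/2, 0), and the two slit balls meet in the ball minus the
    -- horizontal axis.
    have hO (s : ℝ) : IsOpen {y : Fin 2 → ℝ | 0 < s * y 0 ∨ y 1 ≠ 0} :=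
      (isOpen_lt continuous_const (continuous_const.mul c0)).union (isOpen_ne_fun c1 continuous_const)
    have hdiff (s : ℝ) : (B \ {0}) ∩ {y : Fin 2 → ℝ | 0 < s * y 0 ∨ y 1 ≠ 0} =
        B ∩ {y : Fin 2 → ℝ | 0 < s * y 0 ∨ y 1 ≠ 0} := by
      ext y
      refine ⟨fun h => ⟨h.1.1, h.2⟩, fun h => ⟨⟨h.1, ?_⟩, h.2⟩⟩
      rintro rfl
      simpa using h.2
    have hqB (s : ℝ) (hs : s ^ 2 = 1) : (![s / 2, 0] : Fin 2 → ℝ) ∈ B := by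
      refine hball.2 fun i => ?_
      fin_cases i
      · simp only [Fin.zero_eta, Matrix.cons_val_zero, abs_lt]
        constructor <;> nlinarith
      · simp
    have hq (s : ℝ) (hs : s ^ 2 = 1) : (![s / 2, 0] : Fin 2 → ℝ) ∈
        (B \ {0}) ∩ {y : Fin 2 → ℝ | 0 < s * y 0 ∨ y 1 ≠ 0} := by
      rw [hdiff]
      refine ⟨hqB s hs, Or.inl ?_⟩
      simp only [Matrix.cons_val_zero]
      nlinarith
    have hstar (s : ℝ) (hs : s ^ 2 = 1) : StarConvex ℝ (![s / 2, 0] : Fin 2 → ℝ)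
        ((B \ {0}) ∩ {y : Fin 2 → ℝ | 0 < s * y 0 ∨ y 1 ≠ 0}) := by
      rw [hdiff]
      rintro y ⟨hyB, hy⟩ a b ha hb hab
      refine ⟨hconv (hqB s hs) hyB ha hb hab, ?_⟩
      simp only [Set.mem_ofPred_eq, Pi.add_apply, Pi.smul_apply, smul_eq_mul, Matrix.cons_val_zero,
        Matrix.cons_val_one, mul_zero, zero_add]
      rw [show s * (a * (s / 2) + b * y 0) = a * s ^ 2 / 2 + b * (s * y 0) by ring, hs]
      rcases hb.eq_or_lt with rfl | hb'
      · left; linarith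
      · rcases hy with hy | hy
        · left; positivity
        · right; positivity
    refine .mayerVietoris (isOpenCover_image hs hsub (hO 1) (hO (-1)) ?_)
      ((CohomologyBound.image_of_starConvex he hs (Set.inter_subset_left.trans hsub) (hq 1 (by simp))
        (hstar 1 (by simp))).mono one_le_two)
      ((CohomologyBound.image_of_starConvex he hs (Set.inter_subset_left.trans hsub)
        (hq (-1) (by simp)) (hstar (-1) (by simp))).mono one_le_two) ?_
    · rintro y ⟨-, hy⟩
      by_contra hcon
      refine hy (funext fun i => ?_)
      simp at hcon
      fin_cases i
      · exact le_antisymm hcon.1.1 hcon.2.1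
      · exact hcon.1.2
    · rw [← e.injOn.image_inter (Set.inter_subset_left.trans hsub)
        (Set.inter_subset_left.trans hsub)]
      have : (B \ {0}) ∩ {y : Fin 2 → ℝ | 0 < 1 * y 0 ∨ y 1 ≠ 0} ∩
          ((B \ {0}) ∩ {y : Fin 2 → ℝ | 0 < -1 * y 0 ∨ y 1 ≠ 0}) =
          B ∩ {y | ContinuousLinearMap.proj (R := ℝ) (φ := fun _ : Fin 2 => ℝ) 1 y ≠ 0} := by
        rw [hdiff, hdiff]
        ext y
        simp only [Set.mem_inter_iff, Set.mem_ofPred_eq, ContinuousLinearMap.proj_apply]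
        grind
      rw [this]
      exact .image_off_hyperplane he hs hsrc.ge hconv _ (p := fun _ => 1 / 2) (m := fun _ => -1 / 2)
        (hball.2 fun _ => by norm_num [abs_lt]) (hball.2 fun _ => by norm_num [abs_lt])
        (by norm_num) (by norm_num)

/-! ### Attaching a cell -/

/-- The space obtained by attaching a punctured cell to `E` deforms into `E`. -/
theorem CohomologyBound.punctured_attachment [T2Space X] {n d : ℕ} {E : Set X} (hE : IsClosed E)
    {e : PartialEquiv (Fin n → ℝ) X} (hsrc : e.source = Metric.ball 0 1)
    (he : ContinuousOn e (Metric.closedBall 0 1)) (hsph : e '' Metric.sphere 0 1 ⊆ E)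
    (hdisj : Disjoint (e '' Metric.ball 0 1) E) (h : CohomologyBound w E d) :
    CohomologyBound w ((E ∪ e '' Metric.closedBall 0 1) \ {e 0}) d := by
  classical
  have h0 : (0 : Fin n → ℝ) ∈ Metric.ball (0 : Fin n → ℝ) 1 := by simp
  have hE0 : e 0 ∉ E := fun h => Set.disjoint_left.1 hdisj ⟨0, h0, rfl⟩ h
  set A := (E ∪ e '' Metric.closedBall 0 1) \ {e 0}
  have hEA : E ⊆ A := fun x hx => ⟨Or.inl hx, by rintro rfl; exact hE0 hx⟩
  have hcases {y : Fin n → ℝ} (hy : y ∈ Metric.closedBall (0 : Fin n → ℝ) 1) :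
      (y ∈ Metric.ball (0 : Fin n → ℝ) 1 ∧ e y ∉ E ∧ e.symm (e y) = y) ∨ (‖y‖ = 1 ∧ e y ∈ E) := by
    rcases (mem_closedBall_zero_iff.1 hy).lt_or_eq with hlt | heq
    · have hb := mem_ball_zero_iff.2 hlt
      exact .inl ⟨hb, fun h => Set.disjoint_left.1 hdisj ⟨y, hb, rfl⟩ h, e.left_inv (hsrc ▸ hb)⟩
    · exact .inr ⟨heq, hsph ⟨y, mem_sphere_zero_iff_norm.2 heq, rfl⟩⟩
  have hne {y : Fin n → ℝ} (hy : y ∈ Metric.closedBall (0 : Fin n → ℝ) 1) (hyA : e y ∈ A) :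
      y ≠ 0 := by
    rintro rfl; exact hyA.2 rfl
  -- Radial push to the unit sphere; it is constant in t when ‖y‖ = 1, so it agrees on the frontier
  -- with the constant homotopy on `E`.
  let r (y : Fin n → ℝ) (t : ℝ) : Fin n → ℝ := ((1 - t) + t * ‖y‖⁻¹) • y
  have hr {y : Fin n → ℝ} (hy0 : y ≠ 0) {t : ℝ} (ht : t ∈ unitInterval) :
      ‖r y t‖ = (1 - t) * ‖y‖ + t := by
    have : 0 < ‖y‖ := norm_pos_iff.2 hy0
    have h1 : 0 ≤ 1 - t := by linarith [ht.2]
    have h2 : 0 ≤ t := ht.1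
    rw [norm_smul, Real.norm_of_nonneg (by positivity)]
    field_simp
  have hrmem {y : Fin n → ℝ} (hy : y ∈ Metric.closedBall (0 : Fin n → ℝ) 1) (hy0 : y ≠ 0) {t : ℝ}
      (ht : t ∈ unitInterval) : r y t ∈ Metric.closedBall (0 : Fin n → ℝ) 1 := by
    rw [mem_closedBall_zero_iff] at hy ⊢
    rw [hr hy0 ht]
    nlinarith [ht.1, ht.2]
  have hrA {y : Fin n → ℝ} (hy : y ∈ Metric.closedBall (0 : Fin n → ℝ) 1) (hy0 : y ≠ 0) {t : ℝ}
      (ht : t ∈ unitInterval) : e (r y t) ∈ A := by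
    refine ⟨Or.inr ⟨_, hrmem hy hy0 ht, rfl⟩, fun h => ?_⟩
    rcases hcases (hrmem hy hy0 ht) with ⟨hb, -, -⟩ | ⟨-, hE⟩
    · have h3 := e.injOn (hsrc ▸ hb) (hsrc ▸ h0) h
      have h4 := hr hy0 ht
      rw [h3, norm_zero] at h4
      have : 0 < ‖y‖ := norm_pos_iff.2 hy0
      nlinarith [mul_nonneg ht.1 (sub_nonneg.2 (mem_closedBall_zero_iff.1 hy))]
    · rw [Set.mem_singleton_iff.1 h] at hE
      exact hE0 hE
  let F (p : A × unitInterval) : X :=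
    if p.1.1 ∈ E then p.1.1 else e (r (e.symm p.1.1) (p.2 : ℝ))
  have hF {y : Fin n → ℝ} (hy : y ∈ Metric.closedBall (0 : Fin n → ℝ) 1) (hyA : e y ∈ A)
      (t : unitInterval) : F (⟨e y, hyA⟩, t) = e (r y t) := by
    rcases hcases hy with ⟨-, hyE, hsymm⟩ | ⟨hnorm, hyE⟩
    · simp [F, hyE, hsymm]
    · simp [F, hyE, r, hnorm]
  have hex {x : X} (hxA : x ∈ A) (hx : x ∉ E) :
      ∃ y ∈ Metric.closedBall (0 : Fin n → ℝ) 1, e y = x := hxA.1.resolve_left hx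
  let q : Metric.closedBall (0 : Fin n → ℝ) 1 → X := fun y => e y
  have hq : Continuous q := he.comp_continuous continuous_subtype_val fun y => y.2
  have : CompactSpace (Metric.closedBall (0 : Fin n → ℝ) 1) :=
    isCompact_iff_compactSpace.1 (isCompact_closedBall 0 1)
  -- Continuity of `F` descends from the closed ball: `q` is proper (compact to Hausdorff), so `P`
  -- is closed, and its image together with the part over `E` covers everything.
  let P : (q ⁻¹' A) × unitInterval → A × unitInterval := Prod.map (A.restrictPreimage q) id
  have hP : IsClosedMap P :=
    ((hq.isProperMap.restrictPreimage A).prodMap isProperMap_id).isClosedMap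
  have hFP : Continuous (F ∘ P) := by
    have : F ∘ P = fun p => e (r p.1.1.1 (p.2 : ℝ)) := by
      ext p
      exact hF p.1.1.2 p.1.2 p.2
    rw [this]
    refine he.comp_continuous ?_ fun p => hrmem p.1.1.2 (hne p.1.1.2 p.1.2) p.2.2
    have hc : Continuous fun p : (q ⁻¹' A) × unitInterval => p.1.1.1 := by fun_prop
    have ht : Continuous fun p : (q ⁻¹' A) × unitInterval => (p.2 : ℝ) := by fun_prop
    exact ((continuous_const.sub ht).add (ht.mul (hc.norm.inv₀ fun p =>
      norm_ne_zero_iff.2 (hne p.1.1.2 p.1.2)))).smul hc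
  have hFc : Continuous F := by
    refine continuous_iff_isClosed.2 fun Z hZ => ?_
    have : F ⁻¹' Z = {p | p.1.1 ∈ E ∩ Z} ∪ P '' ((F ∘ P) ⁻¹' Z) := by
      ext p
      constructor
      · intro hp
        by_cases hpE : p.1.1 ∈ E
        · exact .inl ⟨hpE, by simpa [F, hpE] using hp⟩
        · obtain ⟨y, hy, hya⟩ := hex p.1.2 hpE
          have : P (⟨⟨y, hy⟩, by simp [q, hya]⟩, p.2) = p := Prod.ext (Subtype.ext hya) rfl
          exact .inr ⟨_, by rw [Set.mem_preimage, Function.comp_apply, this]; exact hp, this⟩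
      · rintro (⟨hpE, hpZ⟩ | ⟨p, hp, rfl⟩)
        · simpa [F, hpE] using hpZ
        · exact hp
    rw [this]
    exact ((hE.inter hZ).preimage (continuous_subtype_val.comp continuous_fst)).union
      (hP _ (hZ.preimage hFP))
  refine h.of_homotopy hEA ⟨F, hFc⟩ (fun p => ?_) (fun a => ?_) fun a => ?_
  · obtain ⟨⟨a, haA⟩, t⟩ := p
    by_cases ha : a ∈ E
    · simpa [F, ha] using hEA ha
    · obtain ⟨y, hy, rfl⟩ := hex haA ha
      rw [ContinuousMap.coe_mk, hF hy]
      exact hrA hy (hne hy haA) t.2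
  · obtain ⟨a, haA⟩ := a
    by_cases ha : a ∈ E
    · simp [F, ha]
    · obtain ⟨y, hy, rfl⟩ := hex haA ha
      rw [ContinuousMap.coe_mk, hF hy]
      simp [r]
  · obtain ⟨a, haA⟩ := a
    by_cases ha : a ∈ E
    · simp [F, ha]
    · obtain ⟨y, hy, rfl⟩ := hex haA ha
      rw [ContinuousMap.coe_mk, hF hy]
      refine hsph ⟨_, mem_sphere_zero_iff_norm.2 ?_, rfl⟩
      rw [Set.Icc.coe_one, hr (hne hy haA) (by simp)]
      simp

/-! ### Finite complexes of dimension at most two -/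

-- The frontier hypothesis says that `J` spans a subcomplex. Removing a cell of maximal dimension
-- preserves it, so induction on `J` applies.
open RelCWComplex in
theorem CohomologyBound.iUnion_openCell [T2Space X] [CWComplex (Set.univ : Set X)]
    (hdim : ∀ n : ℕ, 2 < n → IsEmpty (cell (Set.univ : Set X) n))
    (J : Finset (Σ n, cell (Set.univ : Set X) n)) :
    (∀ j ∈ J, cellFrontier j.1 j.2 ⊆ ⋃ i ∈ J, openCell i.1 i.2) →
      CohomologyBound w (⋃ i ∈ J, openCell i.1 i.2) 3 := by
  classical
  induction J using Finset.strongInduction with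
  | H J ih =>
  intro hJ
  rcases J.eq_empty_or_nonempty with rfl | hne
  · simpa using CohomologyBound.empty.mono (Nat.zero_le 3)
  obtain ⟨j, hj, hmax⟩ := J.exists_max_image (fun j => j.1) hne
  set E := ⋃ i ∈ J.erase j, openCell i.1 i.2 with hE
  have hEj : (⋃ i ∈ J, openCell i.1 i.2) = E ∪ openCell j.1 j.2 := by
    rw [← Finset.insert_erase hj, Finset.set_biUnion_insert, Set.union_comm]
  have hdisj : Disjoint (openCell j.1 j.2) E := by
    simp only [hE, Set.disjoint_iUnion_right]
    intro i hi
    exact disjoint_openCell_of_ne (Finset.ne_of_mem_erase hi).symm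
  have hfr (i) (hi : i ∈ J) : cellFrontier i.1 i.2 ⊆ E := by
    intro x hx
    refine ((hEj ▸ hJ i hi) hx).resolve_right fun hxj => ?_
    -- Frontiers lie in open cells of strictly smaller dimension; a frontier meeting the open cell
    -- of `j` would contradict the maximality of its dimension.
    obtain ⟨I, hI⟩ := CWComplex.cellFrontier_subset_finite_openCell i.1 i.2
    simp only [Set.subset_def, Set.mem_iUnion] at hI
    obtain ⟨m, hm, k, -, hk⟩ := hI x hx
    have : (⟨m, k⟩ : Σ n, cell (Set.univ : Set X) n) = j := by
      by_contra hcon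
      exact Set.disjoint_left.1 (disjoint_openCell_of_ne hcon) hk hxj
    have := hmax i hi
    grind
  have hEb : CohomologyBound w E 3 :=
    ih _ (Finset.erase_ssubset hj) fun i hi => hfr i (Finset.mem_of_mem_erase hi)
  have hEc : IsClosed E := by
    have : E = ⋃ i ∈ J.erase j, closedCell i.1 i.2 := by
      refine subset_antisymm (Set.iUnion₂_mono fun i _ => openCell_subset_closedCell _ _) ?_
      refine Set.iUnion₂_subset fun i hi => ?_
      rw [← cellFrontier_union_openCell_eq_closedCell]
      exact Set.union_subset (hfr i (Finset.mem_of_mem_erase hi))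
        (Set.subset_biUnion_of_mem (u := fun i : Σ n, cell (Set.univ : Set X) n =>
          openCell i.1 i.2) hi)
    rw [this]
    exact isClosed_biUnion_finset fun i _ => isClosed_closedCell
  obtain ⟨n, c⟩ := j
  have hn : n ≤ 2 := by
    by_contra h
    exact (hdim n (by omega)).false c
  have hsrc := source_eq (C := (Set.univ : Set X)) n c
  have he := continuousOn (C := (Set.univ : Set X)) n c
  have hs := continuousOn_symm (C := (Set.univ : Set X)) n c
  have he' : ContinuousOn (map n c) (map n c).source := hsrc ▸ he.mono Metric.ball_subset_closedBall
  have hU := hEb.punctured_attachment hEc hsrc he (hfr ⟨n, c⟩ hj) hdisj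
  have hEj' : E ∪ openCell n c = E ∪ map n c '' Metric.closedBall 0 1 := by
    change _ = E ∪ closedCell n c
    rw [← cellFrontier_union_openCell_eq_closedCell, ← Set.union_assoc,
      Set.union_eq_self_of_subset_right (hfr ⟨n, c⟩ hj)]
  rw [← hEj'] at hU
  have h0 : (0 : Fin n → ℝ) ∈ Metric.ball (0 : Fin n → ℝ) 1 := by simp
  have hV : CohomologyBound w (openCell n c) 1 :=
    .image_of_starConvex he' hs hsrc.ge h0 ((convex_ball 0 1).starConvex h0)
  rw [hEj]
  refine .mayerVietoris (U := (E ∪ openCell n c) \ {map n c 0}) (V := openCell n c)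
    ⟨⟨{map n c 0}ᶜ, isOpen_compl_singleton, rfl⟩, ⟨Eᶜ, hEc.isOpen_compl, ?_⟩, ?_⟩ hU
    (hV.mono (by norm_num)) ?_
  · ext x
    have : x ∈ openCell n c → x ∉ E := fun hx => Set.disjoint_left.1 hdisj hx
    simp only [Set.mem_inter_iff, Set.mem_union, Set.mem_compl_iff] at this ⊢
    tauto
  · intro x hx
    by_cases h : x = map n c 0
    · exact .inr (h ▸ map_zero_mem_openCell n c)
    · exact .inl ⟨hx, h⟩
  · have : (E ∪ openCell n c) \ {map n c 0} ∩ openCell n c =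
        map n c '' (Metric.ball 0 1 \ {0}) := by
      ext x
      constructor
      · rintro ⟨⟨-, hx⟩, y, hy, rfl⟩
        exact ⟨y, ⟨hy, by rintro rfl; exact hx rfl⟩, rfl⟩
      · rintro ⟨y, ⟨hy, hy0⟩, rfl⟩
        refine ⟨⟨.inr ⟨y, hy, rfl⟩, fun h => hy0 ?_⟩, ⟨y, hy, rfl⟩⟩
        exact (map n c).injOn (hsrc ▸ hy) (hsrc ▸ h0) h
    rw [this]
    exact (CohomologyBound.image_punctured_ball hn hsrc he' hs).mono hn

open RelCWComplex in
/-- The twisted cohomology of a finite complex of dimension at most two is finitely generated and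
vanishes above degree two. -/
theorem CohomologyBound.of_finite_complex [T2Space X] [CWComplex (Set.univ : Set X)]
    [RelCWComplex.Finite (Set.univ : Set X)]
    (hdim : ∀ n : ℕ, 2 < n → IsEmpty (cell (Set.univ : Set X) n)) :
    CohomologyBound w (Set.univ : Set X) 3 := by
  have := finite_cells_of_finite (C := (Set.univ : Set X))
  have := Fintype.ofFinite (Σ n, cell (Set.univ : Set X) n)
  have hu : (⋃ i ∈ (Finset.univ : Finset (Σ n, cell (Set.univ : Set X) n)), openCell i.1 i.2) =
      Set.univ := by
    refine Eq.trans ?_ (CWComplex.iUnion_openCell_eq_complex (C := (Set.univ : Set X)))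
    ext x
    simp
  have h := CohomologyBound.iUnion_openCell (w := w) hdim Finset.univ
  rw [hu] at h
  exact h fun _ _ => Set.subset_univ _

open RelCWComplex in
/-- A connected finite complex is path connected. -/
theorem pathConnectedSpace_of_finite_complex [T2Space X] [ConnectedSpace X]
    [CWComplex (Set.univ : Set X)] [RelCWComplex.Finite (Set.univ : Set X)] :
    PathConnectedSpace X := by
  have := finite_cells_of_finite (C := (Set.univ : Set X))
  have hpc (i : Σ n, cell (Set.univ : Set X) n) : IsPathConnected (closedCell i.1 i.2) :=
    ((convex_closedBall (0 : Fin i.1 → ℝ) 1).isPathConnected ⟨0, by simp⟩).image'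
      (continuousOn i.1 i.2)
  have hcov (x : X) : ∃ i : Σ n, cell (Set.univ : Set X) n, x ∈ closedCell i.1 i.2 := by
    have := CWComplex.union (C := (Set.univ : Set X)) ▸ Set.mem_univ x
    simpa using this
  -- A union of path components is a finite union of closed cells. Applied to a path component and
  -- to its complement, this shows the component is clopen.
  have hclosed (s : Set X) (hs : ∀ x ∈ s, pathComponent x ⊆ s) : IsClosed s := by
    have : s = ⋃ i ∈ {i : Σ n, cell (Set.univ : Set X) n | closedCell i.1 i.2 ⊆ s},
        closedCell i.1 i.2 := by
      refine subset_antisymm (fun x hx => ?_) (Set.iUnion₂_subset fun i hi => hi)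
      obtain ⟨i, hi⟩ := hcov x
      exact Set.mem_biUnion (x := i) (((hpc i).subset_pathComponent hi).trans (hs x hx)) hi
    rw [this]
    exact (Set.toFinite _).isClosed_biUnion fun i _ => isClosed_closedCell
  obtain ⟨x₀⟩ := (inferInstance : Nonempty X)
  have hclopen : IsClopen (pathComponent x₀) := by
    refine ⟨hclosed _ fun x hx => (pathComponent_congr hx).le, ?_⟩
    rw [← isClosed_compl_iff]
    exact hclosed _ fun x hx y hy hy' => hx (hy'.trans hy.symm)
  exact pathConnectedSpace_iff_eq.2 ⟨x₀, hclopen.eq_univ (pathComponent.nonempty x₀)⟩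

end TwistedSingular

/-! ### From local coefficients to twists, and reduction modulo two. -/

namespace TwistedSingular

open LocalCoeff (Simplex simplexMap segmentPath e₀)
open AffineSimplices (lin lin_vert lin_lin)

variable {X : Type*} [TopologicalSpace X] {x₀ : X}

/-! ### The twist of a homomorphism from the fundamental group -/

section holonomy

variable (α : FundamentalGroup X x₀ →* ℤˣ) (γ : ∀ x, Path.Homotopic.Quotient x₀ x)

/-- The sign of the transport along a path class, relative to the chosen classes `γ`. -/
def holonomy {x y : X} (δ : Path.Homotopic.Quotient x y) : ℤˣ :=
  α (FundamentalGroup.fromPath (((γ x).trans δ).trans (γ y).symm))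

variable {α}

/-- Equivariance is applied to the loop that follows `γ x`, then `δ`, then returns along `γ y`. -/
theorem fibre_apply {y : X} (f : LocalCoeff.fibre α y) {x : X}
    (δ : Path.Homotopic.Quotient x y) :
    f.1 ((γ x).trans δ) = (holonomy α γ δ : ℤ) * f.1 (γ y) := by
  have h := f.2 (FundamentalGroup.fromPath (((γ x).trans δ).trans (γ y).symm)) (γ y)
  rw [holonomy, ← h]
  simp [FundamentalGroup.toPath, FundamentalGroup.fromPath, Path.Homotopic.Quotient.trans_assoc]

variable (α)

theorem holonomy_trans {x y z : X} (δ : Path.Homotopic.Quotient x y)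
    (ε : Path.Homotopic.Quotient y z) :
    holonomy α γ (δ.trans ε) = holonomy α γ δ * holonomy α γ ε := by
  -- Multiplication in `FundamentalGroup` concatenates in the reverse order; commutativity of `ℤˣ`
  -- makes this harmless.
  rw [mul_comm, holonomy, holonomy, holonomy, ← map_mul, FundamentalGroup.mul_def]
  have key (ζ : Path.Homotopic.Quotient y x₀) : (γ y).symm.trans ((γ y).trans ζ) = ζ := by
    rw [← Path.Homotopic.Quotient.trans_assoc, Path.Homotopic.Quotient.symm_trans,
      Path.Homotopic.Quotient.refl_trans]
  simp [FundamentalGroup.fromPath, Path.Homotopic.Quotient.trans_assoc, key]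

/-- The sign of the image under `G` of a path between two points of a simplex. -/
def simplexSign {n : ℕ} (G : C(Simplex n, X)) (y z : Simplex n) : ℤˣ :=
  holonomy α γ ((Path.Homotopic.Quotient.mk (segmentPath y z)).map G)

/-- A simplex is simply connected, so a segment is homotopic to any broken path with the same ends.
-/
theorem simplexSign_mul {n : ℕ} (G : C(Simplex n, X)) (x y z : Simplex n) :
    simplexSign α γ G x y * simplexSign α γ G y z = simplexSign α γ G x z := by
  rw [simplexSign, simplexSign, simplexSign, ← holonomy_trans]
  congr 1
  rw [Subsingleton.elim (Path.Homotopic.Quotient.mk (segmentPath x z))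
    ((Path.Homotopic.Quotient.mk (segmentPath x y)).trans
      (Path.Homotopic.Quotient.mk (segmentPath y z)))]
  simp only [← Path.Homotopic.Quotient.mk_map, ← Path.Homotopic.Quotient.mk_trans]
  rw [Path.map_trans]

theorem simplexSign_comp {m n : ℕ} (G : C(Simplex n, X)) (f : C(Simplex m, Simplex n))
    (y z : Simplex m) :
    simplexSign α γ (G.comp f) y z = simplexSign α γ G (f y) (f z) := by
  rw [simplexSign, simplexSign, Subsingleton.elim
    (Path.Homotopic.Quotient.mk (segmentPath (f y) (f z)))
    ((Path.Homotopic.Quotient.mk (segmentPath y z)).map f)]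
  rfl

theorem simplexMap_vert {m n : ℕ} (f : Fin (m + 1) → Fin (n + 1)) (i : Fin (m + 1)) :
    simplexMap f (vert i) = vert (f i) :=
  stdSimplex.map_vertex f i

/-- The twist of a homomorphism from the fundamental group to `{1, -1}`. -/
def Twist.ofHom : Twist X where
  sign σ := simplexSign α γ σ (vert 0) (vert 1)
  cocycle σ := by
    simp only [simplexSign_comp, simplexMap_vert]
    exact simplexSign_mul α γ σ _ _ _

theorem Twist.ofHom_seg {n : ℕ} (σ : C(Simplex n, X)) (y z : Simplex n) :
    (Twist.ofHom α γ).seg σ y z = simplexSign α γ σ y z := by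
  simp only [Twist.seg, Twist.ofHom, simplexSign_comp, lin_vert]
  rfl

/-! ### Comparison of the cochain complexes -/

/-- Evaluation of the fibre of the local system at the chosen path class. -/
def fibreEquiv (x : X) : LocalCoeff.fibre α x ≃ₗ[ℤ] ℤ where
  toFun f := f.1 (γ x)
  map_add' _ _ := rfl
  map_smul' _ _ := rfl
  invFun a := ⟨fun δ => (α (FundamentalGroup.fromPath (δ.trans (γ x).symm)) : ℤ) * a,
    fun g δ => by
      rw [← mul_assoc, ← Units.val_mul, mul_comm (α g), ← map_mul, FundamentalGroup.mul_def]
      exact congrArg (fun p => (α (FundamentalGroup.fromPath p) : ℤ) * a)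
        (Path.Homotopic.Quotient.trans_assoc g.toPath δ (γ x).symm)⟩
  left_inv f := by
    ext δ
    have h := f.2 (FundamentalGroup.fromPath (δ.trans (γ x).symm)) (γ x)
    refine h.symm.trans ?_
    simp [FundamentalGroup.toPath, FundamentalGroup.fromPath, Path.Homotopic.Quotient.trans_assoc]
  right_inv a := by
    have : (α (FundamentalGroup.fromPath ((γ x).trans (γ x).symm)) : ℤ) = 1 := by
      rw [Path.Homotopic.Quotient.trans_symm]
      exact congrArg Units.val (map_one α)
    simp only [this, one_mul]

/-- Cochains with local coefficients as functionals on singular chains. -/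
def cochainEquiv (n : ℕ) : LocalCoeff.Cochain α n ≃ₗ[ℤ] Cochain X n :=
  (LinearEquiv.piCongrRight fun σ : C(Simplex n, X) => fibreEquiv α γ (σ (e₀ n))).trans
    (Finsupp.llift ℤ ℤ ℤ _)

variable {α} {n : ℕ}

theorem cochainEquiv_apply (φ : LocalCoeff.Cochain α n) (σ : C(Simplex n, X)) :
    cochainEquiv α γ n φ (Chain.of σ) = (φ σ).1 (γ (σ (e₀ n))) := by
  simp [cochainEquiv, fibreEquiv]

theorem cochainEquiv_coboundary (φ : LocalCoeff.Cochain α n) :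
    cochainEquiv α γ (n + 1) (LocalCoeff.coboundary α n φ) =
      (cochainEquiv α γ n φ).comp (bd (Twist.ofHom α γ) n) := by
  refine Chain.hom_ext fun σ => ?_
  rw [cochainEquiv_apply, LinearMap.comp_apply, bd_of, map_sum]
  have hsum : (LocalCoeff.coboundary α n φ σ).1 (γ (σ (e₀ (n + 1)))) = ∑ i : Fin (n + 2),
      (-1 : ℤ) ^ (i : ℕ) * (LocalCoeff.pull α i.succAbove φ σ).1 (γ (σ (e₀ (n + 1)))) := by
    simp [LocalCoeff.coboundary, LinearMap.sum_apply, Finset.sum_apply]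
  rw [hsum]
  refine Finset.sum_congr rfl fun i _ => ?_
  rw [map_smul, cochainEquiv_apply, Twist.ofHom_seg, smul_eq_mul, mul_assoc, ← simplexMap_vert]
  congr 1
  exact fibre_apply γ (φ (σ.comp (simplexMap i.succAbove))) _

theorem mem_ker_coboundary_iff (φ : LocalCoeff.Cochain α n) :
    φ ∈ LinearMap.ker (LocalCoeff.coboundary α n) ↔
      (cochainEquiv α γ n φ).comp (bd (Twist.ofHom α γ) n) = 0 := by
  rw [LinearMap.mem_ker, ← cochainEquiv_coboundary, LinearEquiv.map_eq_zero_iff]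

theorem mem_boundaries_iff (φ : LocalCoeff.Cochain α (n + 1)) :
    φ ∈ LocalCoeff.boundaries α (n + 1) ↔
      ∃ ψ : Cochain X n, cochainEquiv α γ (n + 1) φ = ψ.comp (bd (Twist.ofHom α γ) n) := by
  constructor
  · rintro ⟨ψ, rfl⟩
    exact ⟨_, cochainEquiv_coboundary γ ψ⟩
  · rintro ⟨ψ, hψ⟩
    refine ⟨(cochainEquiv α γ n).symm ψ, (cochainEquiv α γ (n + 1)).injective ?_⟩
    rw [cochainEquiv_coboundary, hψ, LinearEquiv.apply_symm_apply]

end holonomy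

theorem mem_cocycles_univ_iff {w : Twist X} {n : ℕ} {φ : Cochain X n} :
    φ ∈ cocycles w (inSet Set.univ) n ↔ φ.comp (bd w n) = 0 :=
  ⟨fun h => Chain.hom_ext fun σ => h σ fun _ => trivial, fun h _ _ => LinearMap.congr_fun h _⟩

theorem mem_coboundaries_univ_iff {w : Twist X} {n : ℕ} {φ : Cochain X (n + 1)} :
    φ ∈ coboundaries w (inSet Set.univ) (n + 1) ↔ ∃ ψ : Cochain X n, φ = ψ.comp (bd w n) :=
  ⟨fun ⟨ψ, h⟩ => ⟨ψ, Chain.hom_ext fun σ => h σ fun _ => trivial⟩,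
    fun ⟨ψ, h⟩ => ⟨ψ, fun _ _ => LinearMap.congr_fun h _⟩⟩

/-- Cohomology with local coefficients embeds in cochains modulo twisted coboundaries, with image
inside that of the twisted cocycles. -/
theorem finite_cohomology (α : FundamentalGroup X x₀ →* ℤˣ)
    (γ : ∀ x, Path.Homotopic.Quotient x₀ x) {d : ℕ}
    (h : CohomologyBound (Twist.ofHom α γ) (Set.univ : Set X) d) (n : ℕ) :
    Module.Finite ℤ (LocalCoeff.Cohomology α (n + 1)) := by
  obtain ⟨F, hF, hle⟩ := h.fg (n + 1)
  set B := coboundaries (Twist.ofHom α γ) (inSet (Set.univ : Set X)) (n + 1)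
  set Z := LinearMap.ker (LocalCoeff.coboundary α (n + 1))
  let f : Z →ₗ[ℤ] (Cochain X (n + 1) ⧸ B) :=
    B.mkQ.comp ((cochainEquiv α γ (n + 1)).toLinearMap.comp Z.subtype)
  have hrange : (LinearMap.range f).FG := by
    refine (fg_map_mkQ hF hle).of_le ?_
    rintro _ ⟨z, rfl⟩
    exact Submodule.mem_map_of_mem
      (mem_cocycles_univ_iff.2 ((mem_ker_coboundary_iff γ z.1).1 z.2))
  have hker : LinearMap.ker f = (LocalCoeff.boundaries α (n + 1)).submoduleOf Z := by
    ext z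
    rw [LinearMap.mem_ker, Submodule.submoduleOf, Submodule.mem_comap,
      Submodule.subtype_apply, mem_boundaries_iff γ, ← mem_coboundaries_univ_iff]
    exact Submodule.Quotient.mk_eq_zero B
  have : Module.Finite ℤ (LinearMap.range f) := Module.Finite.iff_fg.2 hrange
  exact Module.Finite.equiv
    ((Submodule.quotEquivOfEq _ _ hker).symm.trans f.quotKerEquivRange).symm

/-! ### Reduction modulo two -/

theorem exists_eq_two_smul {n : ℕ} {θ : Cochain X n} (h : ∀ σ, (2 : ℤ) ∣ θ (Chain.of σ)) :
    ∃ ψ : Cochain X n, θ = (2 : ℤ) • ψ := by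
  choose g hg using h
  refine ⟨Finsupp.linearCombination ℤ g, Chain.hom_ext fun σ => ?_⟩
  simp [hg]

/-- The face coefficients of the two boundaries are signs, and 1 and −1 agree modulo 2. -/
theorem exists_comp_bd_sub_eq (w w' : Twist X) {n : ℕ} (φ : Cochain X n) :
    ∃ ψ : Cochain X (n + 1), φ.comp (bd w n) - φ.comp (bd w' n) = (2 : ℤ) • ψ := by
  refine exists_eq_two_smul fun σ => ?_
  simp only [LinearMap.sub_apply, LinearMap.comp_apply, bd_of, map_sum, map_smul,
    ← Finset.sum_sub_distrib, ← sub_smul, ← mul_sub]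
  refine Finset.dvd_sum fun i _ => ?_
  rw [smul_eq_mul]
  refine Dvd.dvd.mul_right (Dvd.dvd.mul_left ?_ _) _
  rcases Int.units_eq_one_or (w.seg σ (vert 0) (vert (i.succAbove 0))) with h | h <;>
  rcases Int.units_eq_one_or (w'.seg σ (vert 0) (vert (i.succAbove 0))) with h' | h' <;>
  simp [h, h']

theorem two_smul_cancel {n : ℕ} {φ ψ : Cochain X n} (h : (2 : ℤ) • φ = (2 : ℤ) • ψ) : φ = ψ := by
  refine Chain.hom_ext fun σ => ?_
  have := LinearMap.congr_fun h (Chain.of σ)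
  simp only [LinearMap.smul_apply, smul_eq_mul] at this
  linarith

/-- The second twisted cohomology is divisible by two. -/
def TwoDivisible (w : Twist X) : Prop :=
  ∀ z : Cochain X 2, z.comp (bd w 2) = 0 → ∃ v : Cochain X 2, ∃ u : Cochain X 1,
    v.comp (bd w 2) = 0 ∧ z = (2 : ℤ) • v + u.comp (bd w 1)

theorem comp_bd_bd (w : Twist X) {n : ℕ} (φ : Cochain X n) :
    (φ.comp (bd w n)).comp (bd w (n + 1)) = 0 :=
  LinearMap.ext fun c => by simp [bd_bd]

/-- A `w'`-cocycle `z` is a `w`-cocycle modulo 2. Its Bockstein `y` lies in the third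
`w`-cohomology, which vanishes, so `z` can be corrected by an even cochain to a true `w`-cocycle.
Divisibility for `w` then writes `z` as a `w`-coboundary modulo 2, which is also a `w'`-coboundary
modulo 2. -/
theorem TwoDivisible.transfer {w w' : Twist X}
    (h₃ : CohomologyBound w (Set.univ : Set X) 3) (h : TwoDivisible w) : TwoDivisible w' := by
  intro z hz
  obtain ⟨y, hy⟩ := exists_comp_bd_sub_eq w w' z
  rw [hz, sub_zero] at hy
  have hyc : y.comp (bd w 3) = 0 := by
    refine two_smul_cancel ?_
    rw [← LinearMap.smul_comp, ← hy, comp_bd_bd, smul_zero]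
  obtain ⟨x, rfl⟩ := mem_coboundaries_univ_iff.1
    (h₃.vanish 3 le_rfl (mem_cocycles_univ_iff.2 hyc))
  obtain ⟨v', u, -, hv'⟩ := h (z - (2 : ℤ) • x) (by
    rw [LinearMap.sub_comp, LinearMap.smul_comp, hy, sub_self])
  obtain ⟨t, ht⟩ := exists_comp_bd_sub_eq w w' u
  have hzv : z = (2 : ℤ) • (x + v' + t) + u.comp (bd w' 1) := by
    rw [smul_add, smul_add, ← ht, ← sub_add_cancel z ((2 : ℤ) • x), hv']
    abel
  -- The new half is automatically a `w'`-cocycle: its double is `z` minus a coboundary, and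
  -- cochains have no 2-torsion.
  refine ⟨x + v' + t, u, LinearMap.ext fun c => ?_, hzv⟩
  have h1 := LinearMap.congr_fun hzv (bd w' 2 c)
  have h2 := LinearMap.congr_fun hz c
  simp only [LinearMap.comp_apply, LinearMap.add_apply, LinearMap.smul_apply, LinearMap.zero_apply,
    smul_eq_mul, bd_bd, map_zero] at h1 h2 ⊢
  linarith

theorem twoDivisible_iff (α : FundamentalGroup X x₀ →* ℤˣ)
    (γ : ∀ x, Path.Homotopic.Quotient x₀ x) :
    TwoDivisible (Twist.ofHom α γ) ↔
      ∀ x : LocalCoeff.Cohomology α 2, ∃ y : LocalCoeff.Cohomology α 2, x = (2 : ℤ) • y := by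
  constructor
  · intro h x
    obtain ⟨z, rfl⟩ := Submodule.Quotient.mk_surjective _ x
    obtain ⟨v, u, hv, hz⟩ := h _ ((mem_ker_coboundary_iff γ z.1).1 z.2)
    refine ⟨Submodule.Quotient.mk ⟨(cochainEquiv α γ 2).symm v,
      (mem_ker_coboundary_iff γ _).2 (by simpa using hv)⟩, ?_⟩
    rw [← Submodule.Quotient.mk_smul, Submodule.Quotient.eq, Submodule.submoduleOf,
      Submodule.mem_comap, Submodule.subtype_apply,
      mem_boundaries_iff γ]
    exact ⟨u, by simp [hz]⟩
  · intro h z hz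
    obtain ⟨y, hy⟩ := h (Submodule.Quotient.mk ⟨(cochainEquiv α γ 2).symm z,
      (mem_ker_coboundary_iff γ _).2 (by simpa using hz)⟩)
    obtain ⟨v, rfl⟩ := Submodule.Quotient.mk_surjective _ y
    rw [← Submodule.Quotient.mk_smul, Submodule.Quotient.eq, Submodule.submoduleOf,
      Submodule.mem_comap, Submodule.subtype_apply,
      mem_boundaries_iff γ] at hy
    obtain ⟨u, hu⟩ := hy
    refine ⟨cochainEquiv α γ 2 v.1, u, (mem_ker_coboundary_iff γ v.1).1 v.2, ?_⟩
    rw [← hu]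
    simp

theorem forall_exists_eq_two_smul_of_odd_card {A : Type*} [AddCommGroup A] [Finite A]
    (h : Odd (Nat.card A)) (x : A) : ∃ y : A, x = (2 : ℤ) • y := by
  obtain ⟨k, hk⟩ := h
  -- k + 1 is the inverse of 2 modulo the order 2k + 1.
  refine ⟨((k : ℤ) + 1) • x, ?_⟩
  have h1 : ((2 * k + 1 : ℕ) : ℤ) • x = 0 := by rw [← hk, natCast_zsmul, card_nsmul_eq_zero']
  rw [smul_smul, show (2 : ℤ) * (k + 1) = ((2 * k + 1 : ℕ) : ℤ) + 1 by push_cast; ring, add_smul, h1]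
  simp

theorem finite_odd_card_of_two_divisible {A : Type*} [AddCommGroup A] [Module.Finite ℤ A]
    (h : ∀ x : A, ∃ y : A, x = (2 : ℤ) • y) : Finite A ∧ Odd (Nat.card A) := by
  -- Nakayama for the ideal (2) gives an odd integer r killing the group. Being finitely generated
  -- and torsion, the group is finite; an element of order 2 would force r to be even.
  obtain ⟨r, hr, hr0⟩ := Submodule.exists_sub_one_mem_and_smul_eq_zero_of_fg_of_le_smul
    (Ideal.span {(2 : ℤ)}) (⊤ : Submodule ℤ A) Module.Finite.fg_top fun x _ => by
      obtain ⟨y, rfl⟩ := h x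
      exact Submodule.smul_mem_smul (Ideal.mem_span_singleton_self 2) trivial
  rw [Ideal.mem_span_singleton] at hr
  have hrne : r ≠ 0 := by rintro rfl; omega
  have hfin : Finite A := Module.finite_of_fg_torsion A fun x =>
    ⟨⟨r, mem_nonZeroDivisors_of_ne_zero hrne⟩, hr0 x trivial⟩
  refine ⟨hfin, ?_⟩
  by_contra hodd
  rw [Nat.not_odd_iff_even, even_iff_two_dvd] at hodd
  have := Fintype.ofFinite A
  rw [Nat.card_eq_fintype_card] at hodd
  have : Fact (Nat.Prime 2) := ⟨Nat.prime_two⟩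
  obtain ⟨x, hx⟩ := exists_prime_addOrderOf_dvd_card 2 hodd
  have h2 : ((addOrderOf x : ℕ) : ℤ) ∣ r := addOrderOf_dvd_iff_zsmul_eq_zero.2 (hr0 x trivial)
  rw [hx] at h2
  push_cast at h2
  omega

end TwistedSingular

end

theorem theorem2p1 {K : Type*} [TopologicalSpace K] [T2Space K] [ConnectedSpace K]
    [CWComplex (Set.univ : Set K)] [RelCWComplex.Finite (Set.univ : Set K)]
    (hdim : ∀ n : ℕ, 2 < n → IsEmpty (RelCWComplex.cell (Set.univ : Set K) n)) (x₀ : K)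
    (h : ∃ β : FundamentalGroup K x₀ →* ℤˣ,
      Finite (LocalCoeff.Cohomology β 2) ∧ Odd (Nat.card (LocalCoeff.Cohomology β 2))) :
    ∀ α : FundamentalGroup K x₀ →* ℤˣ,
      Finite (LocalCoeff.Cohomology α 2) ∧ Odd (Nat.card (LocalCoeff.Cohomology α 2)) := by
  intro α
  obtain ⟨β, hfin, hodd⟩ := h
  have := TwistedSingular.pathConnectedSpace_of_finite_complex (X := K)
  let γ (x : K) : Path.Homotopic.Quotient x₀ x :=
    Path.Homotopic.Quotient.mk (PathConnectedSpace.somePath x₀ x)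
  have hβ : TwistedSingular.TwoDivisible (TwistedSingular.Twist.ofHom β γ) :=
    (TwistedSingular.twoDivisible_iff β γ).2
      (TwistedSingular.forall_exists_eq_two_smul_of_odd_card hodd)
  have hα : TwistedSingular.TwoDivisible (TwistedSingular.Twist.ofHom α γ) :=
    -- Here the bound for `β` supplies vanishing in degree 3; the bound for `α` is used next, for
    -- finite generation in degree 2.
    hβ.transfer (.of_finite_complex hdim)
  have := TwistedSingular.finite_cohomology α γ (.of_finite_complex hdim) 1
  exact TwistedSingular.finite_odd_card_of_two_divisible
    ((TwistedSingular.twoDivisible_iff α γ).1 hα)
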